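/- Let $p\ge 0$ and let $0=k_0<k_1<\dots<k_p<k_{p+1}=n$ be integers; put $n_i=k_i-k_{i-1}$ for $i=1,\dots,p+1$. Let $\mathrm{Flag}(k_1,\dots,k_p,\mathbb{R}^n)$ be the smooth manifold of flags $\mathbb{W}_1\subseteq\dots\subseteq\mathbb{W}_p\subseteq\mathbb{R}^n$ with $\dim\mathbb{W}_i=k_i$, on which $\mathrm{SO}_n(\mathbb{R})$ acts by $Q\cdot(\mathbb{W}_1\subseteq\dots\subseteq\mathbb{W}_p)=(Q\mathbb{W}_1\subseteq\dots\subseteq Q\mathbb{W}_p)$, and let $\mathsf{S}^2_\circ(\mathbb{R}^n)$ be the space of traceless real symmetric $n\times n$ matrices, on which $\mathrm{SO}_n(\mathbb{R})$ acts by conjugation, $Q\cdot X=QXQ^{\mathsf T}$. Then $\mathrm{Flag}(k_1,\dots,k_p,\mathbb{R}^n)$ admits an $\mathrm{SO}_n(\mathbb{R})$-equivariant smooth embedding into $\mathsf{S}^2_\circ(\mathbb{R}^n)$. More precisely: (i) there are distinct real numbers $a_1,\dots,a_{p+1}$ with $\sum_{i=1}^{p+1} n_i a_i=0$; (ii) for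 all distinct real numbers $a_1,\dots,a_{p+1}$ with $\sum_{i=1}^{p+1} n_i a_i=0$, let $I_{\alpha,\mu}=\mathrm{diag}(a_1I_{n_1},\dots,a_{p+1}I_{n_{p+1}})\in\mathsf{S}^2_\circ(\mathbb{R}^n)$. The stabilizer of $I_{\alpha,\mu}$ in $\mathrm{SO}_n(\mathbb{R})$ is $$\mathrm{S}(\mathrm{O}_{n_1}(\mathbb{R})\times\dots\times\mathrm{O}_{n_{p+1}}(\mathbb{R}))=\{\mathrm{diag}(X_1,\dots,X_{p+1}): X_i\in\mathrm{O}_{n_i}(\mathbb{R}),\ \det(X_1)\cdots\det(X_{p+1})=1\},$$ and there is an $\mathrm{SO}_n(\mathbb{R})$-equivariant smooth embedding $\varepsilon:\mathrm{Flag}(k_1,\dots,k_p,\mathbb{R}^n)\to\mathsf{S}^2_\circ(\mathbb{R}^n)$ that sends the standard flag (whose $i$-th subspace is spanned by the first $k_i$ standard basis vectors) to $I_{\alpha,\mu}$ and whose image is the conjugation orbit $\{Q I_{\alpha,\mu}Q^{\mathsf T}: Q\in\mathrm{SO}_n(\mathbb{R})\}$. -/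

import Mathlib

open scoped Manifold ContDiff Matrix

noncomputable section

/-! ### The integers `0 = k₀ < k₁ < ⋯ < k_p < k_{p+1} = n` -/

/-- Integers `0 = k₀ < k₁ < ⋯ < k_p < k_{p+1} = n`. -/
structure FlagType (p n : ℕ) where
  k : Fin (p + 2) → ℕ
  k_zero : k 0 = 0
  k_last : k (Fin.last (p + 1)) = n
  k_strictMono : StrictMono k

namespace FlagType

variable {p n : ℕ} (κ : FlagType p n)

/-- The multiplicities `n_i = k_i - k_{i-1}`; the entry `i : Fin (p + 1)` is `n_{i+1}`. -/
def mult (i : Fin (p + 1)) : ℕ := κ.k i.succ - κ.k i.castSucc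

theorem exists_block (j : Fin n) :
    ∃ i : Fin (p + 1), κ.k i.castSucc ≤ j ∧ (j : ℕ) < κ.k i.succ := by
  by_contra! h
  have key : ∀ i, κ.k i ≤ j := fun i =>
    Fin.induction (by rw [κ.k_zero]; exact Nat.zero_le _) (fun i hi => h i hi) i
  have := key (Fin.last (p + 1))
  rw [κ.k_last] at this
  omega

/-- The block `i` to which a row or column index `j` belongs: `k_i ≤ j < k_{i+1}`, with indices
counted from `0`. -/
def block (j : Fin n) : Fin (p + 1) := (κ.exists_block j).choose

theorem le_block (j : Fin n) : κ.k (κ.block j).castSucc ≤ j := (κ.exists_block j).choose_spec.1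

theorem lt_block (j : Fin n) : (j : ℕ) < κ.k (κ.block j).succ := (κ.exists_block j).choose_spec.2

theorem lt_block_iff (i : Fin (p + 1)) (j : Fin n) : i < κ.block j ↔ κ.k i.succ ≤ j := by
  constructor
  · intro h
    exact (κ.k_strictMono.monotone (Fin.succ_le_castSucc_iff.2 h)).trans (κ.le_block j)
  · intro h
    by_contra! h'
    have := κ.k_strictMono.monotone (Fin.succ_le_succ_iff.2 h')
    have := κ.lt_block j
    omega

theorem block_eq_iff (i : Fin (p + 1)) (j : Fin n) :
    κ.block j = i ↔ κ.k i.castSucc ≤ j ∧ (j : ℕ) < κ.k i.succ := by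
  constructor
  · rintro rfl
    exact ⟨κ.le_block j, κ.lt_block j⟩
  · rintro ⟨h1, h2⟩
    apply le_antisymm
    · by_contra! h
      have := (κ.lt_block_iff i j).1 h
      omega
    · by_contra! h
      have := κ.k_strictMono.monotone (Fin.succ_le_castSucc_iff.2 h)
      have := κ.lt_block j
      omega

theorem k_le (i : Fin (p + 2)) : κ.k i ≤ n := by
  have := κ.k_strictMono.monotone (Fin.le_last i)
  rwa [κ.k_last] at this

theorem card_block (i : Fin (p + 1)) : Fintype.card {j : Fin n // κ.block j = i} = κ.mult i := by
  have h1 : Fintype.card {j : Fin n // κ.block j = i}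
      = (Finset.univ.filter fun j : Fin n => κ.block j = i).card := Fintype.card_subtype _
  rw [h1, mult, ← Nat.card_Ico, ← Finset.card_map Fin.valEmbedding]
  congr 1
  ext m
  simp only [Finset.mem_map, Finset.mem_filter, Finset.mem_univ, true_and, Fin.valEmbedding_apply,
    κ.block_eq_iff, Finset.mem_Ico]
  constructor
  · rintro ⟨j, h, rfl⟩
    exact h
  · intro h
    exact ⟨⟨m, h.2.trans_le (κ.k_le _)⟩, h, rfl⟩

/-- The positions strictly below the block diagonal. Their number
`(n² - ∑ n_i²) / 2` is the dimension of the flag manifold. -/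
abbrev Cell : Type := {rc : Fin n × Fin n // κ.block rc.2 < κ.block rc.1}

end FlagType

/-! ### Flags -/

/-- The set of `(k₁, …, k_p)`-flags `W₁ ⊆ ⋯ ⊆ W_p` in `ℝⁿ`, where `dim W_i = k_i`. The entry
`i : Fin p` of `W` is `W_{i+1}`. -/
@[ext]
structure FlagManifold {p n : ℕ} (κ : FlagType p n) where
  W : Fin p → Submodule ℝ (Fin n → ℝ)
  mono : Monotone W
  finrank_eq : ∀ i, Module.finrank ℝ (W i) = κ.k i.castSucc.succ

/-- The group `SO_n(ℝ)`. -/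
abbrev SO (n : ℕ) : Type := ↥(Matrix.specialOrthogonalGroup (Fin n) ℝ)

theorem SO.transpose_mul {n : ℕ} (Q : SO n) : (Q.1)ᵀ * Q.1 = 1 :=
  Matrix.mem_orthogonalGroup_iff' (Fin n) ℝ |>.1 Q.2.1

theorem SO.mul_transpose {n : ℕ} (Q : SO n) : Q.1 * (Q.1)ᵀ = 1 :=
  Matrix.mem_orthogonalGroup_iff (Fin n) ℝ |>.1 Q.2.1

theorem SO.isUnit {n : ℕ} (Q : SO n) : IsUnit Q.1 :=
  ⟨⟨Q.1, (Q.1)ᵀ, Q.mul_transpose, Q.transpose_mul⟩, rfl⟩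

namespace FlagManifold

variable {p n : ℕ} {κ : FlagType p n}

/-- The image `(A W₁ ⊆ ⋯ ⊆ A W_p)` of a flag under an invertible matrix `A`. -/
def map (A : Matrix (Fin n) (Fin n) ℝ) (hA : IsUnit A) (F : FlagManifold κ) : FlagManifold κ where
  W i := (F.W i).map A.mulVecLin
  mono i j h := Submodule.map_mono (F.mono h)
  finrank_eq i := by
    rw [← F.finrank_eq i]
    exact (LinearEquiv.finrank_eq
      (Submodule.equivMapOfInjective _ (Matrix.mulVec_injective_of_isUnit hA) (F.W i))).symm

theorem map_map (A B : Matrix (Fin n) (Fin n) ℝ) (hA : IsUnit A) (hB : IsUnit B)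
    (F : FlagManifold κ) : (F.map B hB).map A hA = F.map (A * B) (hA.mul hB) := by
  ext1
  funext i
  simp only [map, Matrix.mulVecLin_mul, Submodule.map_comp]

theorem map_one (F : FlagManifold κ) : F.map 1 isUnit_one = F := by
  ext1
  funext i
  simp only [map, Matrix.mulVecLin_one, Submodule.map_id]

/-- `SO_n(ℝ)` acts on flags by `Q • (W₁ ⊆ ⋯ ⊆ W_p) = (Q W₁ ⊆ ⋯ ⊆ Q W_p)`. -/
instance : MulAction (SO n) (FlagManifold κ) where
  smul Q F := F.map Q.1 Q.isUnit
  one_smul F := F.map_one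
  mul_smul Q R F := (map_map Q.1 R.1 Q.isUnit R.isUnit F).symm

theorem smul_def (Q : SO n) (F : FlagManifold κ) : Q • F = F.map Q.1 Q.isUnit := rfl

/-- The coordinate subspace of `ℝⁿ` spanned by the first `m` standard basis vectors. -/
def coordSpace (n m : ℕ) : Submodule ℝ (Fin n → ℝ) :=
  LinearMap.ker (LinearMap.funLeft ℝ ℝ (Subtype.val : {r : Fin n // m ≤ r} → Fin n))

theorem mem_coordSpace {n m : ℕ} {x : Fin n → ℝ} :
    x ∈ coordSpace n m ↔ ∀ r : Fin n, m ≤ r → x r = 0 := by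
  rw [coordSpace, LinearMap.mem_ker]
  constructor
  · intro h r hr
    exact congrFun h ⟨r, hr⟩
  · intro h
    funext r
    exact h r.1 r.2

theorem finrank_coordSpace {n m : ℕ} (h : m ≤ n) : Module.finrank ℝ (coordSpace n m) = m := by
  have h1 := LinearMap.finrank_range_add_finrank_ker
    (LinearMap.funLeft ℝ ℝ (Subtype.val : {r : Fin n // m ≤ r} → Fin n))
  rw [LinearMap.range_eq_top.2 (LinearMap.funLeft_surjective_of_injective ℝ ℝ _
    Subtype.val_injective), finrank_top, Module.finrank_fintype_fun_eq_card,
    Module.finrank_fintype_fun_eq_card, Fintype.card_fin] at h1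
  have h2 : Fintype.card {r : Fin n // m ≤ r} = n - m := by
    have h3 : Fintype.card {r : Fin n // m ≤ r}
        = (Finset.univ.filter fun r : Fin n => m ≤ r).card := Fintype.card_subtype _
    rw [h3, ← Nat.card_Ico, ← Finset.card_map Fin.valEmbedding]
    congr 1
    ext a
    simp only [Finset.mem_map, Finset.mem_filter, Finset.mem_univ, true_and,
      Fin.valEmbedding_apply, Finset.mem_Ico]
    constructor
    · rintro ⟨j, h, rfl⟩
      exact ⟨h, j.2⟩
    · intro h
      exact ⟨⟨a, h.2⟩, h.1, rfl⟩
  change _ + Module.finrank ℝ (coordSpace n m) = n at h1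
  omega

/-- The standard flag, whose `i`-th subspace is spanned by the first `k_i` standard basis
vectors. -/
def std (κ : FlagType p n) : FlagManifold κ where
  W i := coordSpace n (κ.k i.castSucc.succ)
  mono i j h x hx := by
    rw [mem_coordSpace] at hx ⊢
    intro r hr
    exact hx r ((κ.k_strictMono.monotone (by simpa using h)).trans hr)
  finrank_eq i := finrank_coordSpace (κ.k_le _)

theorem mem_std {i : Fin p} {x : Fin n → ℝ} :
    x ∈ (std κ).W i ↔ ∀ r, i.castSucc < κ.block r → x r = 0 := by
  simp only [κ.lt_block_iff]
  exact mem_coordSpace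

/-! ### The smooth structure

The chart centred at `g • std κ`, for `g ∈ SO_n(ℝ)`, is the inverse of the parametrization
`x ↦ g (1 + N(x)) • std κ` of the big cell by the strictly block lower triangular matrices. -/

/-- The strictly block lower triangular matrix with entries `x`. -/
def lower (κ : FlagType p n) (x : κ.Cell → ℝ) : Matrix (Fin n) (Fin n) ℝ :=
  Matrix.of fun r c => if h : κ.block c < κ.block r then x ⟨(r, c), h⟩ else 0

/-- If `(1 + N(x)) z` vanishes in the coordinates in the blocks `≤ i`, then so does `z`. -/
theorem eq_zero_of_lower (x : κ.Cell → ℝ) (i : Fin (p + 1)) (z : Fin n → ℝ)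
    (h : ∀ r, κ.block r ≤ i → ((1 + lower κ x) *ᵥ z) r = 0) : ∀ r, κ.block r ≤ i → z r = 0 := by
  suffices H : ∀ m : ℕ, ∀ r, (κ.block r : ℕ) = m → κ.block r ≤ i → z r = 0 from
    fun r hr => H _ r rfl hr
  intro m
  induction m using Nat.strong_induction_on with
  | _ m ih =>
    intro r hm hr
    have h1 := h r hr
    rw [Matrix.add_mulVec, Matrix.one_mulVec, Pi.add_apply] at h1
    have h2 : (lower κ x *ᵥ z) r = 0 := by
      simp only [Matrix.mulVec, dotProduct]
      refine Finset.sum_eq_zero fun c _ => ?_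
      by_cases hc : κ.block c < κ.block r
      · rw [ih _ (hm ▸ hc) c rfl (hc.le.trans hr), mul_zero]
      · simp [lower, hc]
    rwa [h2, add_zero] at h1

theorem isUnit_lower (x : κ.Cell → ℝ) : IsUnit (1 + lower κ x) := by
  rw [Matrix.isUnit_iff_isUnit_det, isUnit_iff_ne_zero]
  intro h
  obtain ⟨v, hv, h0⟩ := Matrix.exists_mulVec_eq_zero_iff.2 h
  exact hv (funext fun r => eq_zero_of_lower x (Fin.last p) v (fun r _ => congrFun h0 r) r
    (Fin.le_last _))

/-- The parametrization of the big cell around `g • std κ`. -/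
def param (κ : FlagType p n) (g : SO n) (x : κ.Cell → ℝ) : FlagManifold κ :=
  g • (std κ).map (1 + lower κ x) (isUnit_lower x)

/-- The square submatrix of `A` on the indices in the blocks `≤ i`. -/
def minor (κ : FlagType p n) (A : Matrix (Fin n) (Fin n) ℝ) (i : Fin (p + 1)) :
    Matrix {d // κ.block d ≤ i} {d // κ.block d ≤ i} ℝ :=
  A.submatrix Subtype.val Subtype.val

/-- The coordinates of the flag `A • std κ` in the big cell around `std κ`. -/
def coord (κ : FlagType p n) (A : Matrix (Fin n) (Fin n) ℝ) (rc : κ.Cell) : ℝ :=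
  ∑ d : {d // κ.block d ≤ κ.block rc.1.2},
    A rc.1.1 d.1 * (minor κ A (κ.block rc.1.2))⁻¹ d ⟨rc.1.2, le_rfl⟩

/-- Extension by zero from the indices in the blocks `≤ i`. -/
def ext0 (κ : FlagType p n) (i : Fin (p + 1)) (u : {d // κ.block d ≤ i} → ℝ) (r : Fin n) : ℝ :=
  if h : κ.block r ≤ i then u ⟨r, h⟩ else 0

theorem mulVec_ext0 (A : Matrix (Fin n) (Fin n) ℝ) (i : Fin (p + 1))
    (u : {d // κ.block d ≤ i} → ℝ) (r : Fin n) :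
    (A *ᵥ ext0 κ i u) r = ∑ d : {d // κ.block d ≤ i}, A r d.1 * u d := by
  have h1 : (A *ᵥ ext0 κ i u) r
      = ∑ d ∈ Finset.univ.filter (fun d => κ.block d ≤ i), A r d * ext0 κ i u d := by
    rw [Finset.sum_filter_of_ne]
    · rfl
    · intro d _ hd
      by_contra h
      exact hd (by simp [ext0, h])
  rw [h1, Finset.sum_subtype (p := fun d => κ.block d ≤ i) _ (by simp)]
  refine Finset.sum_congr rfl fun d _ => ?_
  simp [ext0, d.2]

theorem ext0_mem_std (i : Fin (p + 1)) (j : Fin p) (h : i ≤ j.castSucc)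
    (u : {d // κ.block d ≤ i} → ℝ) : ext0 κ i u ∈ (std κ).W j := by
  rw [mem_std]
  intro r hr
  simp [ext0, h.trans_lt hr]

theorem eq_ext0 {j : Fin p} {w : Fin n → ℝ} (hw : w ∈ (std κ).W j) :
    w = ext0 κ j.castSucc fun d => w d.1 := by
  rw [mem_std] at hw
  funext r
  by_cases h : κ.block r ≤ j.castSucc
  · simp [ext0, h]
  · simp [ext0, h, hw r (not_le.1 h)]

theorem lower_apply_of_le (x : κ.Cell → ℝ) {r c : Fin n} (h : κ.block r ≤ κ.block c) :
    (1 + lower κ x) r c = (1 : Matrix (Fin n) (Fin n) ℝ) r c := by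
  simp [lower, h]

theorem lower_apply_cell (x : κ.Cell → ℝ) (rc : κ.Cell) :
    (1 + lower κ x) rc.1.1 rc.1.2 = x rc := by
  have h : rc.1.1 ≠ rc.1.2 := fun h => (lt_irrefl _ (h ▸ rc.2 : κ.block rc.1.1 < κ.block rc.1.1))
  have h2 := rc.2
  simp [lower, h, h2]

/-- A flag `A • std κ` with nonvanishing minors lies in the big cell. -/
theorem map_lower_coord (A : Matrix (Fin n) (Fin n) ℝ) (hA : IsUnit A)
    (h : ∀ i : Fin p, (minor κ A i.castSucc).det ≠ 0) :
    (std κ).map (1 + lower κ (coord κ A)) (isUnit_lower _) = (std κ).map A hA := by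
  ext1
  funext i
  refine Submodule.eq_of_le_of_finrank_eq ?_ ?_
  · rintro _ ⟨z, hz, rfl⟩
    have hz' : z ∈ (std κ).W i := hz
    rw [mem_std] at hz'
    have hsum : (1 + lower κ (coord κ A)).mulVecLin z
        = ∑ c, z c • (1 + lower κ (coord κ A)).col c := by
      rw [Matrix.mulVecLin_apply, Matrix.mulVec_eq_sum]
      simp [Matrix.col]
    rw [hsum]
    refine Submodule.sum_mem _ fun c _ => ?_
    by_cases hc : κ.block c ≤ i.castSucc
    swap
    · rw [hz' c (not_le.1 hc), zero_smul]
      exact Submodule.zero_mem _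
    refine Submodule.smul_mem _ _ ⟨ext0 κ (κ.block c)
      (fun d => (minor κ A (κ.block c))⁻¹ d ⟨c, le_rfl⟩), ext0_mem_std _ _ hc _, ?_⟩
    rw [Matrix.mulVecLin_apply]
    funext r
    rw [mulVec_ext0]
    change _ = (1 + lower κ (coord κ A)) r c
    by_cases hr : κ.block r ≤ κ.block c
    · rw [lower_apply_of_le _ hr]
      obtain ⟨j, hj⟩ : ∃ j : Fin p, j.castSucc = κ.block c :=
        Fin.exists_castSucc_eq.2 (hc.trans_lt i.castSucc_lt_last).ne
      have hdet : IsUnit (minor κ A (κ.block c)).det := by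
        rw [← hj]
        exact (h j).isUnit
      have := congrFun (congrFun (Matrix.mul_nonsing_inv _ hdet) ⟨r, hr⟩) ⟨c, le_rfl⟩
      rw [Matrix.mul_apply] at this
      refine Eq.trans this ?_
      simp [Matrix.one_apply]
    · exact (lower_apply_cell (coord κ A) ⟨(r, c), not_le.1 hr⟩).symm
  · exact (((std κ).map _ (isUnit_lower (coord κ A))).finrank_eq i).trans
      (((std κ).map A hA).finrank_eq i).symm

theorem det_minor_ne_zero {A : Matrix (Fin n) (Fin n) ℝ} {hA : IsUnit A} {y : κ.Cell → ℝ}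
    (h : (std κ).map (1 + lower κ y) (isUnit_lower _) = (std κ).map A hA) (i : Fin p) :
    (minor κ A i.castSucc).det ≠ 0 := by
  intro h0
  obtain ⟨u, hu, hu0⟩ := Matrix.exists_mulVec_eq_zero_iff.2 h0
  have hmem : A.mulVecLin (ext0 κ i.castSucc u) ∈ ((std κ).map A hA).W i :=
    ⟨_, ext0_mem_std _ _ le_rfl u, rfl⟩
  rw [← h] at hmem
  obtain ⟨z, hz, hzA⟩ := hmem
  have hz' : z ∈ (std κ).W i := hz
  rw [mem_std] at hz'
  rw [Matrix.mulVecLin_apply, Matrix.mulVecLin_apply] at hzA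
  have hz0 : z = 0 := by
    have := eq_zero_of_lower y i.castSucc z fun r hr => by
      rw [hzA, mulVec_ext0]
      exact congrFun hu0 ⟨r, hr⟩
    funext r
    by_cases hr : κ.block r ≤ i.castSucc
    · exact this r hr
    · exact hz' r (not_le.1 hr)
  rw [hz0, Matrix.mulVec_zero] at hzA
  have he : ext0 κ i.castSucc u = 0 :=
    Matrix.mulVec_injective_of_isUnit hA (by rw [← hzA, Matrix.mulVec_zero])
  refine hu (funext fun d => ?_)
  have := congrFun he d.1
  simpa [ext0, d.2] using this

theorem coord_eq {A : Matrix (Fin n) (Fin n) ℝ} {hA : IsUnit A} {y : κ.Cell → ℝ}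
    (h : (std κ).map (1 + lower κ y) (isUnit_lower _) = (std κ).map A hA) : coord κ A = y := by
  funext rc
  obtain ⟨⟨r, c⟩, hrc⟩ := rc
  obtain ⟨j, hj⟩ : ∃ j : Fin p, j.castSucc = κ.block c :=
    Fin.exists_castSucc_eq.2 (hrc.trans_le (Fin.le_last _)).ne
  have hdet : IsUnit (minor κ A (κ.block c)).det := by
    rw [← hj]
    exact (det_minor_ne_zero h j).isUnit
  have hmem : (1 + lower κ y).mulVecLin (Pi.single c 1) ∈
      ((std κ).map (1 + lower κ y) (isUnit_lower _)).W j := by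
    refine ⟨_, mem_std.2 fun d hd => ?_, rfl⟩
    rw [hj] at hd
    exact Pi.single_eq_of_ne (fun e => (e ▸ hd).false) _
  rw [h] at hmem
  obtain ⟨w, hw, hwA⟩ := hmem
  have hw' := eq_ext0 hw
  have hcol : ∀ s, (A *ᵥ w) s = (1 + lower κ y) s c := fun s => by
    have := congrFun hwA s
    rw [Matrix.mulVecLin_apply, Matrix.mulVecLin_apply, Matrix.mulVec_single_one] at this
    exact this
  rw [hw', hj] at hcol
  simp only [mulVec_ext0] at hcol
  have hinv : (fun d : {d // κ.block d ≤ κ.block c} => w d.1)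
      = fun d => (minor κ A (κ.block c))⁻¹ d ⟨c, le_rfl⟩ := by
    have h1 : minor κ A (κ.block c) *ᵥ (fun d => w d.1) = Pi.single ⟨c, le_rfl⟩ 1 := by
      funext s
      refine (hcol s.1).trans ?_
      rw [lower_apply_of_le _ s.2]
      simp [Matrix.one_apply, Pi.single_apply, Subtype.ext_iff]
    have h2 := congrArg (fun v => (minor κ A (κ.block c))⁻¹ *ᵥ v) h1
    simp only [Matrix.mulVec_mulVec, Matrix.nonsing_inv_mul _ hdet, Matrix.one_mulVec,
      Matrix.mulVec_single_one] at h2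
    exact h2
  have h3 := hcol r
  refine Eq.trans ?_ (h3.trans (lower_apply_cell y ⟨(r, c), hrc⟩))
  exact Finset.sum_congr rfl fun d _ => by
    rw [← congrFun hinv d]

theorem param_eq (g : SO n) (x : κ.Cell → ℝ) :
    param κ g x = (std κ).map (g.1 * (1 + lower κ x)) (g.isUnit.mul (isUnit_lower x)) :=
  map_map g.1 _ g.isUnit (isUnit_lower x) _

/-- The matrix describing the change of coordinates between two charts. -/
def changeMatrix (g h : SO n) (x : κ.Cell → ℝ) : Matrix (Fin n) (Fin n) ℝ :=
  (h.1)ᵀ * (g.1 * (1 + lower κ x))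

theorem isUnit_changeMatrix (g h : SO n) (x : κ.Cell → ℝ) : IsUnit (changeMatrix g h x) :=
  (IsUnit.mul ⟨⟨(h.1)ᵀ, h.1, h.transpose_mul, h.mul_transpose⟩, rfl⟩
    (g.isUnit.mul (isUnit_lower x)))

theorem param_eq_param_iff (g h : SO n) (x y : κ.Cell → ℝ) :
    param κ h y = param κ g x ↔ (std κ).map (1 + lower κ y) (isUnit_lower y)
      = (std κ).map (changeMatrix g h x) (isUnit_changeMatrix g h x) := by
  have hu : IsUnit (h.1)ᵀ := ⟨⟨(h.1)ᵀ, h.1, h.transpose_mul, h.mul_transpose⟩, rfl⟩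
  have e : (std κ).map (changeMatrix g h x) (isUnit_changeMatrix g h x)
      = (param κ g x).map (h.1)ᵀ hu := by
    rw [param_eq, map_map]
    rfl
  rw [e]
  constructor
  · intro H
    rw [← H, param, smul_def, map_map]
    simp only [h.transpose_mul, map_one]
  · intro H
    rw [param, H, smul_def, map_map]
    simp only [h.mul_transpose, map_one]

theorem param_injective (g : SO n) : Function.Injective (param κ g) := by
  intro x y hxy
  have h1 := (param_eq_param_iff g g y x).1 hxy
  have h2 := (param_eq_param_iff g g y y).1 rfl
  rw [← coord_eq h1, coord_eq h2]

theorem param_mem_range_iff (g h : SO n) (x : κ.Cell → ℝ) :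
    param κ g x ∈ Set.range (param κ h) ↔
      ∀ i : Fin p, (minor κ (changeMatrix g h x) i.castSucc).det ≠ 0 := by
  constructor
  · rintro ⟨y, hy⟩ i
    exact det_minor_ne_zero ((param_eq_param_iff g h x y).1 hy) i
  · intro H
    exact ⟨_, (param_eq_param_iff g h x _).2 (map_lower_coord _ _ H)⟩

/-- The chart centred at `g • std κ`: the inverse of the parametrization `param κ g`. -/
def chart (κ : FlagType p n) (g : SO n) : PartialEquiv (FlagManifold κ) (κ.Cell → ℝ) where
  toFun := Function.invFun (param κ g)
  invFun := param κ g
  source := Set.range (param κ g)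
  target := Set.univ
  map_source' _ _ := Set.mem_univ _
  map_target' x _ := Set.mem_range_self x
  left_inv' _ h := Function.invFun_eq h
  right_inv' x _ := Function.leftInverse_invFun (param_injective g) x

theorem chart_trans_source (g h : SO n) :
    ((chart κ g).symm.trans (chart κ h)).source
      = {x | ∀ i : Fin p, (minor κ (changeMatrix g h x) i.castSucc).det ≠ 0} := by
  ext x
  rw [PartialEquiv.trans_source]
  simp only [PartialEquiv.symm_source, Set.mem_inter_iff, Set.mem_preimage, Set.mem_ofPred_eq]
  rw [← param_mem_range_iff]
  exact ⟨fun H => H.2, fun H => ⟨Set.mem_univ _, H⟩⟩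

theorem chart_trans_apply (g h : SO n) {x : κ.Cell → ℝ}
    (hx : x ∈ ((chart κ g).symm.trans (chart κ h)).source) :
    (chart κ g).symm.trans (chart κ h) x = coord κ (changeMatrix g h x) := by
  rw [chart_trans_source] at hx
  refine param_injective h ?_
  have h1 := (param_eq_param_iff g h x _).2 (map_lower_coord _ (isUnit_changeMatrix g h x) hx)
  rw [h1]
  exact Function.invFun_eq ((param_mem_range_iff g h x).2 hx)

theorem contDiff_changeMatrix (g h : SO n) (r c : Fin n) :
    ContDiff ℝ ∞ fun x : κ.Cell → ℝ => changeMatrix g h x r c := by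
  have h1 : ∀ a b, ContDiff ℝ ∞ fun x : κ.Cell → ℝ => (1 + lower κ x) a b := by
    intro a b
    by_cases hab : κ.block b < κ.block a
    · simp only [Matrix.add_apply, lower, Matrix.of_apply, hab, dif_pos]
      exact contDiff_const.add (contDiff_apply ℝ ℝ _)
    · simp only [lower_apply_of_le _ (not_lt.1 hab)]
      exact contDiff_const
  simp only [changeMatrix, Matrix.mul_apply]
  exact ContDiff.sum fun a _ => contDiff_const.mul
    (ContDiff.sum fun b _ => contDiff_const.mul (h1 b c))

theorem contDiff_det {m : Type*} [Fintype m] [DecidableEq m] {E : Type*} [NormedAddCommGroup E]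
    [NormedSpace ℝ E] {M : E → Matrix m m ℝ} (hM : ∀ a b, ContDiff ℝ ∞ fun x => M x a b) :
    ContDiff ℝ ∞ fun x => (M x).det := by
  simp only [Matrix.det_apply]
  refine ContDiff.sum fun σ _ => ContDiff.const_smul _ (contDiff_prod fun i _ => hM _ _)

theorem contDiff_adjugate {m : Type*} [Fintype m] [DecidableEq m] {E : Type*}
    [NormedAddCommGroup E] [NormedSpace ℝ E] {M : E → Matrix m m ℝ}
    (hM : ∀ a b, ContDiff ℝ ∞ fun x => M x a b) (c d : m) :
    ContDiff ℝ ∞ fun x => (M x).adjugate c d := by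
  simp only [Matrix.adjugate_apply]
  refine contDiff_det fun a b => ?_
  by_cases h : a = d
  · subst h
    simp only [Matrix.updateRow_self]
    exact contDiff_const
  · simp only [Matrix.updateRow_ne h]
    exact hM a b

theorem contDiffOn_coord (g h : SO n) :
    ContDiffOn ℝ ∞ (fun x : κ.Cell → ℝ => coord κ (changeMatrix g h x))
      ((chart κ g).symm.trans (chart κ h)).source := by
  rw [contDiffOn_pi]
  rintro ⟨⟨r, c⟩, hrc⟩
  obtain ⟨j, hj⟩ : ∃ j : Fin p, j.castSucc = κ.block c :=
    Fin.exists_castSucc_eq.2 (hrc.trans_le (Fin.le_last _)).ne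
  have hm : ∀ a b, ContDiff ℝ ∞ fun x : κ.Cell → ℝ =>
      minor κ (changeMatrix g h x) (κ.block c) a b := fun a b => contDiff_changeMatrix g h _ _
  simp only [coord]
  refine ContDiffOn.sum fun d _ => (contDiff_changeMatrix g h r d.1).contDiffOn.mul ?_
  simp only [Matrix.inv_def, Matrix.smul_apply, smul_eq_mul, Ring.inverse_eq_inv']
  refine ContDiffOn.mul ((contDiff_det hm).contDiffOn.inv fun x hx => ?_)
    (contDiff_adjugate hm _ _).contDiffOn
  rw [chart_trans_source] at hx
  rw [← hj]
  exact hx j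

theorem isOpen_chart_trans_source (g h : SO n) :
    IsOpen ((chart κ g).symm.trans (chart κ h)).source := by
  rw [chart_trans_source, Set.ofPred_forall]
  refine isOpen_iInter_of_finite fun i => ?_
  exact isOpen_ne_fun (contDiff_det fun a b => contDiff_changeMatrix g h _ _).continuous
    continuous_const

theorem exists_extension {E : Type*} [AddCommGroup E] [Module ℝ E]
    (e : E ≃ₗ[ℝ] (Fin n → ℝ)) (F : FlagManifold κ) :
    ∃ V : Fin (p + 2) → Submodule ℝ E, Monotone V ∧ (∀ i, Module.finrank ℝ (V i) = κ.k i) ∧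
      ∀ (i : Fin p) (x : E), x ∈ V i.castSucc.succ → e x ∈ F.W i := by
  obtain ⟨W, hW⟩ : ∃ W : Fin p → Submodule ℝ E, ∀ i, W i = (F.W i).map e.symm.toLinearMap :=
    ⟨_, fun _ => rfl⟩
  obtain ⟨V, hVdef⟩ : ∃ V : Fin (p + 2) → Submodule ℝ E,
      V = Fin.cons ⊥ (Fin.snoc (α := fun _ => Submodule ℝ E) W ⊤) := ⟨_, rfl⟩
  have V0 : V 0 = ⊥ := by rw [hVdef, Fin.cons_zero]
  have Vmid : ∀ i : Fin p, V i.castSucc.succ = W i := fun i => by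
    rw [hVdef, Fin.cons_succ, Fin.snoc_castSucc]
  have Vlast : V (Fin.last p).succ = ⊤ := by
    rw [hVdef, Fin.cons_succ, Fin.snoc_last]
  clear hVdef
  refine ⟨V, ?_, ?_, ?_⟩
  · intro i j h
    induction i using Fin.cases with
    | zero => rw [V0]; exact bot_le
    | succ i =>
      induction j using Fin.cases with
      | zero => exact absurd h (by simp)
      | succ j =>
        induction j using Fin.lastCases with
        | last => rw [Vlast]; exact le_top
        | cast j =>
          induction i using Fin.lastCases with
          | last => exact absurd h (by simp [Fin.le_def])
          | cast i =>
            rw [Vmid, Vmid, hW, hW]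
            exact Submodule.map_mono (F.mono (by simpa using h))
  · intro i
    induction i using Fin.cases with
    | zero => rw [V0, finrank_bot, κ.k_zero]
    | succ i =>
      induction i using Fin.lastCases with
      | last =>
        rw [Vlast, finrank_top, e.finrank_eq, Module.finrank_fintype_fun_eq_card,
          Fintype.card_fin, Fin.succ_last, κ.k_last]
      | cast i =>
        rw [Vmid, ← F.finrank_eq i, hW]
        exact LinearEquiv.finrank_map_eq e.symm (F.W i)
  · intro i x hx
    rw [Vmid, hW] at hx
    obtain ⟨y, hy, rfl⟩ := hx
    simpa using hy

theorem exists_orthonormal (F : FlagManifold κ) :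
    ∃ v : Fin n → EuclideanSpace ℝ (Fin n), Orthonormal ℝ v ∧
      ∀ (i : Fin p) (c : Fin n), κ.block c ≤ i.castSucc → (fun r => v c r) ∈ F.W i := by
  obtain ⟨V, hV, hdim, hVW⟩ := exists_extension (WithLp.linearEquiv 2 ℝ (Fin n → ℝ)) F
  let U : Fin (p + 1) → Submodule ℝ (EuclideanSpace ℝ (Fin n)) :=
    fun i => (V i.castSucc)ᗮ ⊓ V i.succ
  have hU : ∀ i, Module.finrank ℝ (U i) = Fintype.card {j : Fin n // κ.block j = i} := by
    intro i
    have h1 := Submodule.finrank_add_inf_finrank_orthogonal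
      (hV (Fin.castSucc_lt_succ (i := i)).le)
    rw [hdim, hdim] at h1
    rw [κ.card_block, FlagType.mult]
    change Module.finrank ℝ ↥((V i.castSucc)ᗮ ⊓ V i.succ) = _
    omega
  let o : ∀ i, OrthonormalBasis {j : Fin n // κ.block j = i} ℝ (U i) := fun i =>
    (stdOrthonormalBasis ℝ (U i)).reindex (Fintype.equivOfCardEq (by
      rw [Fintype.card_fin, hU]))
  let v : Fin n → EuclideanSpace ℝ (Fin n) := fun j => (o (κ.block j) ⟨j, rfl⟩ : U (κ.block j))
  have hv : ∀ j i (h : κ.block j = i), v j = (o i ⟨j, h⟩ : U i) := by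
    rintro j _ rfl
    rfl
  have hmem : ∀ j, v j ∈ U (κ.block j) := fun j => (o (κ.block j) ⟨j, rfl⟩).2
  have hlt : ∀ c d, κ.block c < κ.block d → inner ℝ (v c) (v d) = 0 := by
    intro c d h
    have h1 : v c ∈ V (κ.block d).castSucc :=
      hV (Fin.succ_le_castSucc_iff.2 h) (hmem c).2
    exact (Submodule.mem_orthogonal _ _).1 (hmem d).1 _ h1
  refine ⟨v, ?_, ?_⟩
  · rw [orthonormal_iff_ite]
    intro c d
    rcases lt_trichotomy (κ.block c) (κ.block d) with h | h | h
    · rw [hlt c d h, if_neg (fun e => by rw [e] at h; exact h.false)]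
    · rw [hv c _ h, hv d _ rfl]
      have := orthonormal_iff_ite.1 (o (κ.block d)).orthonormal ⟨c, h⟩ ⟨d, rfl⟩
      simpa [Subtype.ext_iff] using this
    · rw [real_inner_comm, hlt d c h, if_neg (fun e => by rw [e] at h; exact h.false)]
  · intro i c hc
    have h1 : v c ∈ V i.castSucc.succ := hV (Fin.succ_le_succ_iff.2 hc) (hmem c).2
    exact hVW i _ h1

/-- Every flag has an adapted positively oriented orthonormal basis. -/
theorem exists_smul_std (F : FlagManifold κ) : ∃ g : SO n, g • std κ = F := by
  obtain ⟨v, hv, hvW⟩ := exists_orthonormal F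
  have hn : 0 < n := by
    have := κ.k_strictMono (Fin.last_pos (n := p))
    rwa [κ.k_zero, κ.k_last] at this
  let M : Matrix (Fin n) (Fin n) ℝ := Matrix.of fun r c => v c r
  have hM : Mᵀ * M = 1 := by
    ext c d
    have := orthonormal_iff_ite.1 hv c d
    rw [Matrix.one_apply, ← this, Matrix.mul_apply, PiLp.inner_apply]
    refine Finset.sum_congr rfl fun r _ => ?_
    simp [M, mul_comm]
  have hdet : M.det * M.det = 1 := by
    have := congrArg Matrix.det hM
    rwa [Matrix.det_mul, Matrix.det_transpose, Matrix.det_one] at this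
  let s : Fin n → ℝ := Function.update 1 ⟨0, hn⟩ M.det
  have hs : ∀ c, s c * s c = 1 := by
    intro c
    by_cases h : c = ⟨0, hn⟩
    · subst h
      simpa [s] using hdet
    · simp [s, h]
  have hprod : ∏ c, s c = M.det := by
    rw [Finset.prod_update_of_mem (Finset.mem_univ _)]
    simp
  let g : SO n := ⟨M * Matrix.diagonal s, by
    rw [Matrix.mem_specialOrthogonalGroup_iff, Matrix.mem_orthogonalGroup_iff']
    refine ⟨?_, ?_⟩
    · rw [Matrix.transpose_mul, Matrix.diagonal_transpose, Matrix.mul_assoc,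
        ← Matrix.mul_assoc Mᵀ, hM, Matrix.one_mul, Matrix.diagonal_mul_diagonal]
      simp [hs]
    · rw [Matrix.det_mul, Matrix.det_diagonal, hprod, hdet]⟩
  refine ⟨g, ?_⟩
  ext1
  funext i
  refine Submodule.eq_of_le_of_finrank_eq ?_ (((g • std κ).finrank_eq i).trans
    (F.finrank_eq i).symm)
  rintro _ ⟨x, hx, rfl⟩
  have hx' : x ∈ (std κ).W i := hx
  rw [mem_std] at hx'
  have hsum : g.1.mulVecLin x = ∑ c, (s c * x c) • (fun r => v c r) := by
    rw [Matrix.mulVecLin_apply]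
    change (M * Matrix.diagonal s) *ᵥ x = _
    rw [← Matrix.mulVec_mulVec]
    funext r
    simp [Matrix.mulVec, dotProduct, M, mul_comm, Matrix.diagonal_apply]
  rw [hsum]
  refine Submodule.sum_mem _ fun c _ => ?_
  by_cases hc : κ.block c ≤ i.castSucc
  · exact Submodule.smul_mem _ _ (hvW i c hc)
  · rw [hx' c (not_le.1 hc), mul_zero, zero_smul]
    exact Submodule.zero_mem _

theorem mem_chart_source (g : SO n) : g • std κ ∈ (chart κ g).source := by
  refine ⟨0, ?_⟩
  have h0 : (1 : Matrix (Fin n) (Fin n) ℝ) + lower κ 0 = 1 := by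
    ext r c
    simp [lower]
  simp only [param, h0, map_one]

/-- The charts `chart κ g`, for `g ∈ SO_n(ℝ)`, form an atlas. -/
def chartedSpaceCore (κ : FlagType p n) :
    ChartedSpaceCore (κ.Cell → ℝ) (FlagManifold κ) where
  atlas := Set.range (chart κ)
  chartAt F := chart κ (exists_smul_std F).choose
  mem_chart_source F := by
    have h := mem_chart_source (κ := κ) (exists_smul_std F).choose
    rwa [(exists_smul_std F).choose_spec] at h
  chart_mem_atlas _ := Set.mem_range_self _
  open_source := by
    rintro _ _ ⟨g, rfl⟩ ⟨h, rfl⟩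
    exact isOpen_chart_trans_source g h
  continuousOn_toFun := by
    rintro _ _ ⟨g, rfl⟩ ⟨h, rfl⟩
    exact (contDiffOn_coord g h).continuousOn.congr fun x hx => chart_trans_apply g h hx

instance : TopologicalSpace (FlagManifold κ) := (chartedSpaceCore κ).toTopologicalSpace

instance : ChartedSpace (κ.Cell → ℝ) (FlagManifold κ) := (chartedSpaceCore κ).toChartedSpace

instance : IsManifold 𝓘(ℝ, κ.Cell → ℝ) ∞ (FlagManifold κ) := by
  refine isManifold_of_contDiffOn _ _ _ ?_
  intro e e' he he'
  simp only [atlas, ChartedSpace.atlas, chartedSpaceCore, Set.mem_iUnion] at he he'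
  obtain ⟨_, ⟨g, rfl⟩, rfl⟩ := he
  obtain ⟨_, ⟨h, rfl⟩, rfl⟩ := he'
  simp only [modelWithCornersSelf_coe, modelWithCornersSelf_coe_symm, Function.comp_id,
    Function.id_comp, Set.preimage_id, Set.range_id, Set.inter_univ]
  exact (contDiffOn_coord g h).congr fun x hx => chart_trans_apply g h hx

end FlagManifold

/-! ### Traceless symmetric matrices -/

attribute [local instance] Matrix.normedAddCommGroup Matrix.normedSpace

/-- The space `Sym²_∘(ℝⁿ)` of traceless symmetric matrices. -/
def SymTraceless (n : ℕ) : Submodule ℝ (Matrix (Fin n) (Fin n) ℝ) where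
  carrier := {X | Xᵀ = X ∧ X.trace = 0}
  zero_mem' := by simp
  add_mem' := by
    rintro X Y ⟨h1, h2⟩ ⟨h3, h4⟩
    simp [h1, h2, h3, h4]
  smul_mem' := by
    rintro c X ⟨h1, h2⟩
    simp [h1, h2]

/-- The topology and smooth structure of this finite-dimensional real vector space are the usual
ones; they do not depend on the choice of norm. -/
instance (n : ℕ) : NormedAddCommGroup (SymTraceless n) := Submodule.normedAddCommGroup _

instance (n : ℕ) : NormedSpace ℝ (SymTraceless n) := Submodule.normedSpace _

instance (n : ℕ) : TopologicalSpace (SymTraceless n) :=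
  (inferInstance : PseudoMetricSpace (SymTraceless n)).toUniformSpace.toTopologicalSpace

/-- The topology is the subspace topology of the usual topology of `ℝ^{n × n}`. -/
theorem SymTraceless.isEmbedding_val (n : ℕ) :
    Topology.IsEmbedding (Subtype.val : SymTraceless n → Matrix (Fin n) (Fin n) ℝ) :=
  Topology.IsEmbedding.subtypeVal

/-- `SO_n(ℝ)` acts linearly on `Sym²_∘(ℝⁿ)` by conjugation, `Q • X = Q X Qᵀ`. -/
instance (n : ℕ) : DistribMulAction (SO n) (SymTraceless n) where
  smul Q X := ⟨Q.1 * X.1 * (Q.1)ᵀ, by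
    obtain ⟨h1, h2⟩ := X.2
    refine ⟨?_, ?_⟩
    · simp [Matrix.transpose_mul, h1, Matrix.mul_assoc]
    · rw [Matrix.trace_mul_comm, ← Matrix.mul_assoc, Q.transpose_mul, Matrix.one_mul, h2]⟩
  one_smul X := Subtype.ext (by change 1 * X.1 * 1ᵀ = X.1; simp)
  mul_smul Q R X := Subtype.ext (by
    change (Q.1 * R.1) * X.1 * (Q.1 * R.1)ᵀ = Q.1 * (R.1 * X.1 * (R.1)ᵀ) * (Q.1)ᵀ
    simp [Matrix.transpose_mul, Matrix.mul_assoc])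
  smul_zero Q := Subtype.ext (by change Q.1 * 0 * (Q.1)ᵀ = 0; simp)
  smul_add Q X Y := Subtype.ext (by
    change Q.1 * (X.1 + Y.1) * (Q.1)ᵀ = Q.1 * X.1 * (Q.1)ᵀ + Q.1 * Y.1 * (Q.1)ᵀ
    simp [Matrix.mul_add, Matrix.add_mul])

namespace FlagType

variable {p n : ℕ} (κ : FlagType p n)

theorem trace_diagonal_block (a : Fin (p + 1) → ℝ) :
    (Matrix.diagonal fun j => a (κ.block j)).trace = ∑ i, (κ.mult i : ℝ) * a i := by
  rw [Matrix.trace_diagonal, ← Finset.sum_fiberwise Finset.univ κ.block]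
  refine Finset.sum_congr rfl fun i _ => ?_
  rw [← κ.card_block i, Fintype.card_subtype, ← nsmul_eq_mul, ← Finset.sum_const]
  exact Finset.sum_congr rfl fun j hj => by rw [(Finset.mem_filter.1 hj).2]

/-- The block-diagonal matrix `diag(a₁ I_{n₁}, …, a_{p+1} I_{n_{p+1}})`, where
`∑ n_i a_i = 0`, as a traceless symmetric matrix. -/
def blockScalar (a : Fin (p + 1) → ℝ) (ha : ∑ i, (κ.mult i : ℝ) * a i = 0) : SymTraceless n :=
  ⟨Matrix.diagonal fun j => a (κ.block j), Matrix.diagonal_transpose _,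
    (κ.trace_diagonal_block a).trans ha⟩

/-- The set `S(O_{n₁}(ℝ) × ⋯ × O_{n_{p+1}}(ℝ))` of the block-diagonal matrices
`diag(X₁, …, X_{p+1})` with `X_i ∈ O_{n_i}(ℝ)` and `det X₁ ⋯ det X_{p+1} = 1`. -/
def blockOrthogonal : Set (SO n) :=
  {Q | ∃ X : ∀ i : Fin (p + 1), Matrix {j // κ.block j = i} {j // κ.block j = i} ℝ,
    (∀ i, X i ∈ Matrix.orthogonalGroup {j // κ.block j = i} ℝ) ∧ ∏ i, (X i).det = 1 ∧
    Q.1 = Matrix.reindex (Equiv.sigmaFiberEquiv κ.block) (Equiv.sigmaFiberEquiv κ.block)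
      (Matrix.blockDiagonal' X)}

end FlagType

end

/-!
The idea is to replace a flag `F` by the symmetric matrix `X` whose eigenvalue `a_i` has as
eigenspace the orthogonal complement of one member of `F` in the next; the flag is recovered from
`X` as the flag of sums of eigenspaces.

Write `D = diag(a₁ I_{n₁}, …, a_{p+1} I_{n_{p+1}})`. As the `a_i` are distinct, a matrix
`g ∈ SO_n` commutes with `D` exactly when it is block diagonal
(`FlagType.smul_blockScalar_eq_iff`, `FlagType.mem_blockOrthogonal_iff`).
If `g` fixes the standard flag, then `g` and `g⁻¹ = gᵀ` are block upper triangular, so `g` is block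
diagonal. Hence `g • std ↦ g D gᵀ` is a well-defined equivariant map, `FlagManifold.isospectral`.

*Smoothness.* `D` is a linear combination of the coordinate projections onto the first blocks. If
`g • std = A • std`, the conjugate by `g` of such a projection is `B (Bᵀ B)⁻¹ Bᵀ`, with `B` the
matrix of the corresponding first columns of `A` (`FlagManifold.colProj_eq`). Applied to the
matrices `A` that parametrize a chart, this shows that the map is smooth
(`FlagManifold.contDiff_isospectral_param`).

*A smooth local inverse.* Again because the `a_i` are distinct, Lagrange interpolation gives
polynomials whose values at `X = g D gᵀ` are the orthogonal projections onto the members of the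
flag. The chart coordinates of the flag are rational functions of the entries of these
projections. They are defined where certain minors do not vanish, and a matrix in the image
satisfies this condition only if its flag lies in the chart
(`FlagManifold.isospectral_mem_spectralCell_iff`).

The local inverse makes the derivative of the map injective in every chart, so that the map is an
immersion: by the inverse function theorem it takes the form `u ↦ (u, 0)` in suitable charts
(`isImmersionAtOfComplement_of_injective_fderiv`). As the local inverse is continuous on an open set
whose preimage is contained in the chart, the map is also injective and inducing
(`FlagManifold.isEmbedding_isospectral`).
-/

open scoped Topology

/-! ### Maps with injective derivative are immersions -/

section Immersion

variable {E F V : Type*} [NormedAddCommGroup E] [NormedSpace ℝ E] [FiniteDimensional ℝ E]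
  [NormedAddCommGroup F] [NormedSpace ℝ F] [FiniteDimensional ℝ F]
  [NormedAddCommGroup V] [NormedSpace ℝ V] [FiniteDimensional ℝ V]

/-- An injective linear map extends to a linear equivalence on the product of its domain with any
space of complementary dimension. -/
theorem exists_equiv_prod_extending (T : E →L[ℝ] V) (hT : Function.Injective T)
    (hF : Module.finrank ℝ E + Module.finrank ℝ F = Module.finrank ℝ V) :
    ∃ A : (E × F) ≃L[ℝ] V, ∀ u, A (u, 0) = T u := by
  obtain ⟨C, hC⟩ := Submodule.exists_isCompl T.toLinearMap.range
  have hr : Module.finrank ℝ T.toLinearMap.range = Module.finrank ℝ E :=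
    LinearMap.finrank_range_of_inj hT
  have hCF : Module.finrank ℝ F = Module.finrank ℝ C := by
    have := Submodule.finrank_add_eq_of_isCompl hC
    omega
  let S : F ≃ₗ[ℝ] C := LinearEquiv.ofFinrankEq F C hCF
  let A : (E × F) ≃ₗ[ℝ] V :=
    ((LinearEquiv.ofInjective T.toLinearMap hT).prodCongr S).trans
      (Submodule.prodEquivOfIsCompl _ _ hC)
  refine ⟨A.toContinuousLinearEquiv, fun u => ?_⟩
  change A (u, 0) = T u
  simp [A, Submodule.coe_prodEquivOfIsCompl']

/-- A smooth map `φ` with injective derivative at `u₀` takes the form `u ↦ (u, 0)` in a suitable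
chart of the target: the local inverse of `(u, v) ↦ φ u + v`, where `v` runs through a complement
of the range of the derivative. -/
theorem exists_chart_eq_inclusion {φ : E → V} (hφ : ContDiff ℝ ∞ φ) {u₀ : E}
    (hinj : Function.Injective (fderiv ℝ φ u₀))
    (hF : Module.finrank ℝ E + Module.finrank ℝ F = Module.finrank ℝ V) :
    ∃ (e : OpenPartialHomeomorph V V) (A : (E × F) ≃L[ℝ] V),
      e ∈ IsManifold.maximalAtlas 𝓘(ℝ, V) ∞ V ∧ φ u₀ ∈ e.source ∧
      ∀ᶠ u in 𝓝 u₀, e (φ u) = A (u, 0) := by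
  have : CompleteSpace V := FiniteDimensional.complete ℝ V
  obtain ⟨A, hA⟩ := exists_equiv_prod_extending (F := F) (fderiv ℝ φ u₀) hinj hF
  let G : V → V := fun w => φ (A.symm w).1 + A (0, (A.symm w).2)
  have hG : ContDiff ℝ ∞ G := by fun_prop
  have hGA : ∀ u, G (A (u, 0)) = φ u := fun u => by simp [G, Prod.mk_zero_zero]
  have hG' : HasFDerivAt G (ContinuousLinearEquiv.refl ℝ V : V →L[ℝ] V) (A (u₀, 0)) := by
    have h1 : HasFDerivAt (fun w => (A.symm w).1)
        ((ContinuousLinearMap.fst ℝ E F).comp (A.symm : V →L[ℝ] E × F)) (A (u₀, 0)) :=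
      ((ContinuousLinearMap.fst ℝ E F).comp (A.symm : V →L[ℝ] E × F)).hasFDerivAt
    have h2 : HasFDerivAt (fun w => A (0, (A.symm w).2))
        ((A : E × F →L[ℝ] V).comp ((ContinuousLinearMap.inr ℝ E F).comp
          ((ContinuousLinearMap.snd ℝ E F).comp (A.symm : V →L[ℝ] E × F)))) (A (u₀, 0)) :=
      ((A : E × F →L[ℝ] V).comp ((ContinuousLinearMap.inr ℝ E F).comp
          ((ContinuousLinearMap.snd ℝ E F).comp (A.symm : V →L[ℝ] E × F)))).hasFDerivAt
    have h3 : HasFDerivAt φ (fderiv ℝ φ u₀) (A.symm (A (u₀, 0))).1 := by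
      rw [A.symm_apply_apply]
      exact (hφ.differentiable (by simp) u₀).hasFDerivAt
    refine ((HasFDerivAt.comp (f := fun w => (A.symm w).1) (A (u₀, 0)) h3 h1).add
      h2).congr_fderiv ?_
    ext w
    obtain ⟨⟨u, v⟩, rfl⟩ := A.surjective w
    simp [← hA, ← map_add]
  -- The local inverse is smooth only where the derivative of `G` stays invertible.
  let O : Set V := {w | fderiv ℝ G w ∈ Set.range ((↑) : (V ≃L[ℝ] V) → V →L[ℝ] V)}
  have hO : IsOpen O := ContinuousLinearEquiv.isOpen.preimage (hG.continuous_fderiv (by simp))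
  let d := (hG.contDiffAt.toOpenPartialHomeomorph G hG' (by simp)).restrOpen O hO
  have hd : ∀ w, d w = G w := fun _ => rfl
  have hmem : A (u₀, 0) ∈ d.source :=
    ⟨hG.contDiffAt.mem_toOpenPartialHomeomorph_source hG' (by simp), by
      simp only [O, Set.mem_ofPred_eq]
      exact ⟨_, hG'.fderiv.symm⟩⟩
  refine ⟨d.symm, A, ?_, ?_, ?_⟩
  · refine OpenPartialHomeomorph.mem_maximalAtlas_of_contMDiffOn _ ?_ ?_
    · rw [contMDiffOn_iff_contDiffOn]
      intro y hy
      have hy' : d.symm y ∈ d.source := d.map_target hy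
      obtain ⟨L, hL⟩ : d.symm y ∈ O := hy'.2
      refine (d.contDiffAt_symm (f₀' := L) hy ?_ hG.contDiffAt).contDiffWithinAt
      rw [hL]
      exact (hG.differentiable (by simp) _).hasFDerivAt
    · rw [contMDiffOn_iff_contDiffOn]
      exact hG.contDiffOn
  · rw [← hGA u₀]
    exact d.map_source hmem
  · have hc : Filter.Tendsto (fun u => A (u, (0 : F))) (𝓝 u₀) (𝓝 (A (u₀, 0))) :=
      Continuous.tendsto (by fun_prop) u₀
    filter_upwards [hc (d.open_source.mem_nhds hmem)] with u hu
    rw [← hGA u]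
    exact d.left_inv hu

/-- A map which in a chart is smooth with injective derivative is an immersion. -/
theorem isImmersionAtOfComplement_of_injective_fderiv {M : Type*} [TopologicalSpace M]
    [ChartedSpace E M] [IsManifold 𝓘(ℝ, E) ∞ M] {f : M → V} {x : M}
    {c : OpenPartialHomeomorph M E} (hc : c ∈ IsManifold.maximalAtlas 𝓘(ℝ, E) ∞ M)
    (hx : x ∈ c.source) {φ : E → V} (hφ : ContDiff ℝ ∞ φ)
    (hfφ : ∀ u ∈ c.target, f (c.symm u) = φ u)
    (hinj : Function.Injective (fderiv ℝ φ (c x)))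
    (hF : Module.finrank ℝ E + Module.finrank ℝ F = Module.finrank ℝ V) :
    Manifold.IsImmersionAtOfComplement F 𝓘(ℝ, E) 𝓘(ℝ, V) ∞ f x := by
  obtain ⟨e, A, he, hex, heA⟩ := exists_chart_eq_inclusion (F := F) hφ hinj hF
  obtain ⟨t, ht, hto, hxt⟩ := eventually_nhds_iff.1 heA
  have hfc : Set.EqOn f (φ ∘ c) c.source := fun y hy => by
    rw [Function.comp_apply, ← hfφ _ (c.map_source hy), c.left_inv hy]
  have hs : IsOpen (c.source ∩ c ⁻¹' t) := c.isOpen_inter_preimage hto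
  have hcont : ContinuousAt f x :=
    (hφ.continuous.continuousAt.comp (c.continuousAt hx)).congr
      (hfc.symm.eventuallyEq_of_mem (c.open_source.mem_nhds hx))
  refine Manifold.IsImmersionAtOfComplement.mk_of_continuousAt hcont A
    (c.restr (c.source ∩ c ⁻¹' t)) e ?_ ?_ (restr_mem_maximalAtlas _ hc hs) he ?_
  · rw [c.restr_source' _ hs]
    exact ⟨hx, hx, hxt⟩
  · rw [hfc hx]
    exact hex
  · intro u hu
    simp only [OpenPartialHomeomorph.extend, mfld_simps] at hu ⊢
    rw [hs.interior_eq] at hu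
    rw [hfφ u hu.1]
    have h2 := hu.2.2
    rw [Set.mem_preimage, c.right_inv hu.1] at h2
    exact ht u h2

end Immersion

/-! ### The weights and the stabilizer of the block-scalar matrix -/

namespace FlagType

variable {p n : ℕ} (κ : FlagType p n)

theorem mult_pos (i : Fin (p + 1)) : 0 < κ.mult i :=
  Nat.sub_pos_of_lt (κ.k_strictMono Fin.castSucc_lt_succ)

theorem exists_injective_weights :
    ∃ a : Fin (p + 1) → ℝ, Function.Injective a ∧ ∑ i, (κ.mult i : ℝ) * a i = 0 := by
  have hpos : 0 < ∑ i, (κ.mult i : ℝ) :=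
    Finset.sum_pos (fun i _ => Nat.cast_pos.2 (κ.mult_pos i)) Finset.univ_nonempty
  -- The numbers `0, …, p`, shifted by their weighted mean.
  let m : ℝ := (∑ i, (κ.mult i : ℝ) * (i : ℕ)) / ∑ i, (κ.mult i : ℝ)
  refine ⟨fun i => (i : ℕ) - m, fun i j h => ?_, ?_⟩
  · exact Fin.ext (Nat.cast_injective (R := ℝ) (sub_left_injective h))
  · simp only [mul_sub, Finset.sum_sub_distrib, ← Finset.sum_mul]
    rw [sub_eq_zero, mul_div_cancel₀ _ hpos.ne']

variable {κ} {a : Fin (p + 1) → ℝ} (ha : ∑ i, (κ.mult i : ℝ) * a i = 0)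

theorem coe_smul_blockScalar (g : SO n) :
    ((g • κ.blockScalar a ha : SymTraceless n) : Matrix (Fin n) (Fin n) ℝ)
      = g.1 * Matrix.diagonal (fun j => a (κ.block j)) * (g.1)ᵀ := rfl

/-- The stabilizer condition, in the form `g D = D g`. -/
theorem smul_blockScalar_eq_iff (g : SO n) :
    g • κ.blockScalar a ha = κ.blockScalar a ha ↔
      ∀ r c, a (κ.block r) * g.1 r c = a (κ.block c) * g.1 r c := by
  have key : g • κ.blockScalar a ha = κ.blockScalar a ha ↔
      g.1 * Matrix.diagonal (fun j => a (κ.block j))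
        = Matrix.diagonal (fun j => a (κ.block j)) * g.1 := by
    rw [Subtype.ext_iff, coe_smul_blockScalar]
    change _ = Matrix.diagonal (fun j => a (κ.block j)) ↔ _
    constructor
    · intro h
      rw [← h, Matrix.mul_assoc _ _ g.1, g.transpose_mul, Matrix.mul_one, h]
    · intro h
      rw [h, Matrix.mul_assoc, g.mul_transpose, Matrix.mul_one]
  rw [key, ← Matrix.ext_iff]
  simp only [Matrix.mul_diagonal, Matrix.diagonal_mul]
  exact forall₂_congr fun r c => ⟨fun h => by rw [← h, mul_comm], fun h => by rw [h, mul_comm]⟩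

theorem mem_blockOrthogonal_iff (g : SO n) :
    g ∈ κ.blockOrthogonal ↔ ∀ r c, κ.block r ≠ κ.block c → g.1 r c = 0 := by
  constructor
  · rintro ⟨X, -, -, hX⟩ r c h
    rw [hX, Matrix.reindex_apply, Matrix.submatrix_apply]
    exact Matrix.blockDiagonal'_apply_ne _ _ _ h
  · intro h
    have hblock : g.1 = Matrix.reindex (Equiv.sigmaFiberEquiv κ.block)
        (Equiv.sigmaFiberEquiv κ.block)
        (Matrix.blockDiagonal' fun i => Matrix.toSquareBlock g.1 κ.block i) := by
      ext r c
      obtain ⟨⟨i, r⟩, rfl⟩ := (Equiv.sigmaFiberEquiv κ.block).surjective r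
      obtain ⟨⟨k, c⟩, rfl⟩ := (Equiv.sigmaFiberEquiv κ.block).surjective c
      rw [Matrix.reindex_apply, Matrix.submatrix_apply, Equiv.symm_apply_apply,
        Equiv.symm_apply_apply]
      by_cases hik : i = k
      · subst hik
        rw [Matrix.blockDiagonal'_apply_eq]
        rfl
      · rw [Matrix.blockDiagonal'_apply_ne _ _ _ hik]
        refine h _ _ ?_
        change κ.block r ≠ κ.block c
        rwa [r.2, c.2]
    refine ⟨_, fun i => ?_, ?_, hblock⟩
    · rw [Matrix.mem_orthogonalGroup_iff]
      have h1 := g.mul_transpose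
      rw [hblock, Matrix.reindex_apply, Matrix.transpose_submatrix, Matrix.submatrix_mul_equiv,
        Matrix.blockDiagonal'_transpose, ← Matrix.blockDiagonal'_mul] at h1
      have h2 := congrArg (Matrix.reindex (Equiv.sigmaFiberEquiv κ.block).symm
        (Equiv.sigmaFiberEquiv κ.block).symm) h1
      simp only [Matrix.reindex_apply, Matrix.submatrix_submatrix, Equiv.symm_symm,
        Equiv.symm_comp_self, Matrix.submatrix_id_id, Matrix.submatrix_one_equiv] at h2
      rw [← Matrix.blockDiagonal'_one] at h2
      exact congrFun (Matrix.blockDiagonal'_injective h2) i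
    · have ht : Matrix.BlockTriangular g.1 κ.block := fun r c hrc => h r c hrc.ne'
      rw [← ht.det_fintype]
      exact (Matrix.mem_specialOrthogonalGroup_iff.1 g.2).2

theorem stabilizer_blockScalar (hinj : Function.Injective a) :
    (MulAction.stabilizer (SO n) (κ.blockScalar a ha) : Set (SO n)) = κ.blockOrthogonal := by
  ext g
  rw [SetLike.mem_coe, MulAction.mem_stabilizer_iff, smul_blockScalar_eq_iff,
    mem_blockOrthogonal_iff]
  refine forall₂_congr fun r c => ?_
  rw [mul_eq_mul_right_iff, hinj.eq_iff, or_iff_not_imp_left]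

end FlagType

namespace FlagManifold

variable {p n : ℕ} {κ : FlagType p n}

/-! ### The equivariant map -/

/-- An invertible matrix that fixes the standard flag is block upper triangular. -/
theorem apply_eq_zero_of_map_std {T : Matrix (Fin n) (Fin n) ℝ} {hT : IsUnit T}
    (h : (std κ).map T hT = std κ) {r c : Fin n} (hrc : κ.block c < κ.block r) : T r c = 0 := by
  obtain ⟨j, hj⟩ : ∃ j : Fin p, j.castSucc = κ.block c :=
    Fin.exists_castSucc_eq.2 (hrc.trans_le (Fin.le_last _)).ne
  have hmem : T.mulVecLin (Pi.single c 1) ∈ ((std κ).map T hT).W j := by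
    refine ⟨_, mem_std.2 fun d hd => ?_, rfl⟩
    rw [hj] at hd
    exact Pi.single_eq_of_ne (fun e => (e ▸ hd).false) _
  rw [h, mem_std] at hmem
  have := hmem r (hj ▸ hrc)
  rwa [Matrix.mulVecLin_apply, Matrix.mulVec_single_one] at this

theorem smul_blockScalar_of_smul_std {a : Fin (p + 1) → ℝ}
    (ha : ∑ i, (κ.mult i : ℝ) * a i = 0) {g : SO n} (h : g • std κ = std κ) :
    g • κ.blockScalar a ha = κ.blockScalar a ha := by
  rw [FlagType.smul_blockScalar_eq_iff]
  intro r c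
  rcases lt_trichotomy (κ.block c) (κ.block r) with hrc | hrc | hrc
  · rw [apply_eq_zero_of_map_std (hT := g.isUnit) h hrc, mul_zero, mul_zero]
  · rw [hrc]
  · -- The inverse of `g`, which is its transpose, fixes the standard flag too.
    have h' : g⁻¹ • std κ = std κ := inv_smul_eq_iff.2 h.symm
    have h0 : (g⁻¹).1 c r = 0 := apply_eq_zero_of_map_std (hT := (g⁻¹).isUnit) h' hrc
    have h1 : g.1 r c = 0 := h0
    rw [h1, mul_zero, mul_zero]

/-- The equivariant map from flags to traceless symmetric matrices that sends the standard flag to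
`diag(a₁ I_{n₁}, …, a_{p+1} I_{n_{p+1}})`. On a flag `F = g • std` its value is the conjugate of
that matrix by `g`; it does not depend on the choice of `g`. -/
noncomputable def isospectral (a : Fin (p + 1) → ℝ) (ha : ∑ i, (κ.mult i : ℝ) * a i = 0)
    (F : FlagManifold κ) : SymTraceless n :=
  (exists_smul_std F).choose • κ.blockScalar a ha

variable {a : Fin (p + 1) → ℝ} (ha : ∑ i, (κ.mult i : ℝ) * a i = 0)

theorem isospectral_smul_std (g : SO n) :
    isospectral a ha (g • std κ) = g • κ.blockScalar a ha := by
  have h := (exists_smul_std (g • std κ)).choose_spec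
  rw [isospectral, ← inv_smul_eq_iff, smul_smul]
  apply smul_blockScalar_of_smul_std
  rw [mul_smul, inv_smul_eq_iff, h]

theorem isospectral_smul (g : SO n) (F : FlagManifold κ) :
    isospectral a ha (g • F) = g • isospectral a ha F := by
  obtain ⟨h, rfl⟩ := exists_smul_std F
  rw [← mul_smul, isospectral_smul_std, isospectral_smul_std, mul_smul]

theorem isospectral_std : isospectral a ha (std κ) = κ.blockScalar a ha := by
  simpa using isospectral_smul_std (κ := κ) ha 1

theorem range_isospectral :
    Set.range (isospectral (κ := κ) a ha) = MulAction.orbit (SO n) (κ.blockScalar a ha) := by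
  ext X
  constructor
  · rintro ⟨F, rfl⟩
    obtain ⟨g, rfl⟩ := exists_smul_std F
    exact ⟨g, (isospectral_smul_std ha g).symm⟩
  · rintro ⟨g, rfl⟩
    exact ⟨g • std κ, isospectral_smul_std ha g⟩

/-! ### Orthogonal projections onto the members of a flag -/

/-- The inclusion of the coordinate subspace of the blocks `≤ i`, as a matrix. -/
def incl (κ : FlagType p n) (i : Fin (p + 1)) : Matrix (Fin n) {d // κ.block d ≤ i} ℝ :=
  (1 : Matrix (Fin n) (Fin n) ℝ).submatrix id Subtype.val

theorem mul_incl {m : Type*} (A : Matrix m (Fin n) ℝ) (i : Fin (p + 1)) :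
    A * incl κ i = A.submatrix id Subtype.val := by
  ext r c
  simp [incl, Matrix.mul_apply, Matrix.one_apply]

theorem transpose_incl_mul {m : Type*} (A : Matrix (Fin n) m ℝ) (i : Fin (p + 1)) :
    (incl κ i)ᵀ * A = A.submatrix Subtype.val id := by
  ext r c
  simp [incl, Matrix.mul_apply, Matrix.one_apply]

theorem transpose_incl_mul_incl (i : Fin (p + 1)) : (incl κ i)ᵀ * incl κ i = 1 := by
  rw [transpose_incl_mul, incl, Matrix.submatrix_submatrix]
  exact Matrix.submatrix_one _ Subtype.val_injective

theorem incl_mul_transpose_incl (i : Fin (p + 1)) :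
    incl κ i * (incl κ i)ᵀ = Matrix.diagonal fun j => if κ.block j ≤ i then 1 else 0 := by
  ext r c
  rw [Matrix.mul_apply, Matrix.diagonal_apply]
  simp only [incl, Matrix.submatrix_apply, Matrix.transpose_apply, id, Matrix.one_apply]
  by_cases hr : κ.block r ≤ i
  · rw [Finset.sum_eq_single ⟨r, hr⟩]
    · simp [hr, eq_comm]
    · intro b _ hb
      rw [if_neg (fun e => hb (Subtype.ext e.symm)), zero_mul]
    · simp
  · rw [if_neg hr, ite_self]
    refine Finset.sum_eq_zero fun b _ => ?_
    rw [if_neg (fun e : r = b => hr (e ▸ b.2)), zero_mul]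

theorem minor_eq (A : Matrix (Fin n) (Fin n) ℝ) (i : Fin (p + 1)) :
    minor κ A i = (incl κ i)ᵀ * (A * incl κ i) := by
  rw [mul_incl, transpose_incl_mul, Matrix.submatrix_submatrix]
  rfl

theorem coord_eq_mul (A : Matrix (Fin n) (Fin n) ℝ) (rc : κ.Cell) :
    coord κ A rc = (A * incl κ (κ.block rc.1.2) * (minor κ A (κ.block rc.1.2))⁻¹) rc.1.1
      ⟨rc.1.2, le_rfl⟩ := by
  rw [mul_incl]
  rfl

/-- The orthogonal projection onto the span of the columns of `A` in the blocks `≤ i`, as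
`B (Bᵀ B)⁻¹ Bᵀ`, where `B` consists of these columns. -/
noncomputable def colProj (κ : FlagType p n) (A : Matrix (Fin n) (Fin n) ℝ) (i : Fin (p + 1)) :
    Matrix (Fin n) (Fin n) ℝ :=
  A * incl κ i * ((A * incl κ i)ᵀ * (A * incl κ i))⁻¹ * (A * incl κ i)ᵀ

theorem isUnit_transpose_mul_incl {A : Matrix (Fin n) (Fin n) ℝ} (hA : IsUnit A)
    (i : Fin (p + 1)) : IsUnit ((A * incl κ i)ᵀ * (A * incl κ i)).det := by
  rw [isUnit_iff_ne_zero]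
  intro h
  obtain ⟨v, hv, h0⟩ := Matrix.exists_mulVec_eq_zero_iff.2 h
  have h1 : (A * incl κ i) *ᵥ v = 0 := by
    rw [← Matrix.conjTranspose_eq_transpose_of_trivial] at h0
    exact Matrix.conjTranspose_mul_self_mulVec_eq_zero _ _ |>.1 h0
  rw [← Matrix.mulVec_mulVec] at h1
  have h2 : incl κ i *ᵥ v = 0 :=
    Matrix.mulVec_injective_of_isUnit hA (h1.trans (Matrix.mulVec_zero _).symm)
  refine hv ?_
  rw [← Matrix.one_mulVec v, ← transpose_incl_mul_incl, ← Matrix.mulVec_mulVec, h2,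
    Matrix.mulVec_zero]

/-- If `g ∈ SO_n` and `A` take the standard flag to the same flag, the projections onto the
members of that flag, computed from `A`, are the conjugates by `g` of the coordinate
projections. The reason is that `A = g T` with `T` block upper triangular. -/
theorem colProj_eq {A : Matrix (Fin n) (Fin n) ℝ} {hA : IsUnit A} {g : SO n}
    (h : g • std κ = (std κ).map A hA) (i : Fin (p + 1)) :
    colProj κ A i = g.1 * (incl κ i * (incl κ i)ᵀ) * (g.1)ᵀ := by
  have hg : IsUnit (g.1)ᵀ := (g⁻¹).isUnit
  obtain ⟨T, hTdef⟩ : ∃ T, T = (g.1)ᵀ * A := ⟨_, rfl⟩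
  have hT : IsUnit T := hTdef ▸ hg.mul hA
  have hAT : A = g.1 * T := by
    rw [hTdef, ← Matrix.mul_assoc, g.mul_transpose, Matrix.one_mul]
  have hstd : (std κ).map T hT = std κ := by
    subst hTdef
    rw [← map_map _ _ hg hA, ← h, smul_def, map_map]
    simp only [g.transpose_mul, map_one]
  have hTJ : T * incl κ i = incl κ i * minor κ T i := by
    rw [minor_eq, ← Matrix.mul_assoc, incl_mul_transpose_incl, mul_incl]
    ext r c
    rw [Matrix.diagonal_mul]
    by_cases hr : κ.block r ≤ i
    · simp [hr]
    · simp only [hr, if_false, zero_mul]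
      exact apply_eq_zero_of_map_std hstd (c.2.trans_lt (not_le.1 hr))
  have hB : A * incl κ i = g.1 * incl κ i * minor κ T i := by
    rw [hAT, Matrix.mul_assoc, hTJ, Matrix.mul_assoc]
  have hBB : (A * incl κ i)ᵀ * (A * incl κ i) = (minor κ T i)ᵀ * minor κ T i := by
    rw [hB]
    simp only [Matrix.transpose_mul, Matrix.mul_assoc]
    rw [← Matrix.mul_assoc (g.1)ᵀ, g.transpose_mul, Matrix.one_mul,
      ← Matrix.mul_assoc (incl κ i)ᵀ, transpose_incl_mul_incl, Matrix.one_mul]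
  have hdet : IsUnit (minor κ T i).det := by
    have := isUnit_transpose_mul_incl (κ := κ) hA i
    rw [hBB, Matrix.det_mul] at this
    exact isUnit_of_mul_isUnit_right this
  have hdet' : IsUnit (minor κ T i)ᵀ.det := by rwa [Matrix.det_transpose]
  rw [colProj, hBB, hB, Matrix.mul_inv_rev, Matrix.transpose_mul _ (minor κ T i)]
  simp only [Matrix.transpose_mul, Matrix.mul_assoc]
  rw [Matrix.nonsing_inv_mul_cancel_left _ _ hdet', Matrix.mul_nonsing_inv_cancel_left _ _ hdet]

theorem minor_mul_incl_mul_transpose (A : Matrix (Fin n) (Fin n) ℝ) (i : Fin (p + 1)) :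
    minor κ (A * (incl κ i * (incl κ i)ᵀ) * Aᵀ) i = minor κ A i * (minor κ A i)ᵀ := by
  simp only [minor_eq, Matrix.transpose_mul, Matrix.transpose_transpose, Matrix.mul_assoc]

/-- Let `J` be the inclusion of the blocks up to that of the column `c`, and let `A` have an
invertible leading minor there. Then `A J Jᵀ Aᵀ` and `A` have the same coordinates in the column
`c` of the big cell, because their first columns span the same subspace. For orthogonal `A`, the
matrix `A J Jᵀ Aᵀ` is the projection onto that subspace. -/
theorem coord_mul_incl_mul_transpose (A : Matrix (Fin n) (Fin n) ℝ) (rc : κ.Cell)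
    (h : (minor κ A (κ.block rc.1.2)).det ≠ 0) :
    coord κ (A * (incl κ (κ.block rc.1.2) * (incl κ (κ.block rc.1.2))ᵀ) * Aᵀ) rc
      = coord κ A rc := by
  have hdet : IsUnit (minor κ A (κ.block rc.1.2))ᵀ.det := by
    rw [Matrix.det_transpose]
    exact h.isUnit
  have hmul : ∀ i, A * (incl κ i * (incl κ i)ᵀ) * Aᵀ * incl κ i
      = A * incl κ i * (minor κ A i)ᵀ := fun i => by
    simp only [minor_eq, Matrix.transpose_mul, Matrix.transpose_transpose, Matrix.mul_assoc]
  rw [coord_eq_mul, coord_eq_mul, minor_mul_incl_mul_transpose, hmul, Matrix.mul_inv_rev,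
    Matrix.mul_assoc, Matrix.mul_nonsing_inv_cancel_left _ _ hdet]

end FlagManifold

/-! ### Smoothness in the charts -/

theorem SymTraceless.contDiff_apply (n : ℕ) (r c : Fin n) :
    ContDiff ℝ ∞ fun X : SymTraceless n => X.1 r c :=
  (LinearMap.toContinuousLinearMap
    ((Matrix.entryLinearMap ℝ ℝ r c).comp (SymTraceless n).subtype)).contDiff

/-- A map into the traceless symmetric matrices is smooth if its entries are. -/
theorem SymTraceless.contDiff_of_apply {n : ℕ} {E : Type*} [NormedAddCommGroup E] [NormedSpace ℝ E]
    {f : E → SymTraceless n} (hf : ∀ r c, ContDiff ℝ ∞ fun x => (f x).1 r c) :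
    ContDiff ℝ ∞ f := by
  let ι : SymTraceless n →ₗ[ℝ] (Fin n × Fin n → ℝ) :=
    { toFun := fun X rc => X.1 rc.1 rc.2
      map_add' := fun _ _ => rfl
      map_smul' := fun _ _ => rfl }
  have hι : LinearMap.ker ι = ⊥ := by
    rw [LinearMap.ker_eq_bot]
    intro X Y h
    ext r c
    exact congrFun h (r, c)
  obtain ⟨ρ, hρ⟩ := ι.exists_leftInverse_of_injective hι
  have h1 : f = LinearMap.toContinuousLinearMap ρ ∘ fun x => ι (f x) := by
    funext x
    exact (LinearMap.congr_fun hρ (f x)).symm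
  rw [h1]
  exact (LinearMap.toContinuousLinearMap ρ).contDiff.comp
    (contDiff_pi.2 fun rc => hf rc.1 rc.2)

namespace FlagManifold

variable {p n : ℕ} {κ : FlagType p n} {a : Fin (p + 1) → ℝ}

/-- Summation by parts: the coefficients are the differences of consecutive terms of `a`. -/
theorem exists_sum_le_eq : ∀ {p : ℕ} (a : Fin (p + 1) → ℝ),
    ∃ b : Fin (p + 1) → ℝ, ∀ j, ∑ i, b i * (if j ≤ i then 1 else 0) = a j
  | 0, a => ⟨a, fun j => by rw [Fin.fin_one_eq_zero j]; simp⟩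
  | p + 1, a => by
    obtain ⟨b, hb⟩ := exists_sum_le_eq (Fin.tail a)
    refine ⟨Fin.cons (a 0 - a 1) b, fun j => ?_⟩
    rw [Fin.sum_univ_succ]
    induction j using Fin.cases with
    | zero =>
      have := hb 0
      simp only [Fin.zero_le, if_true, mul_one, Fin.tail, Fin.succ_zero_eq_one] at this
      simp [this]
    | succ j =>
      have := hb j
      simp only [Fin.tail] at this
      simpa using this

theorem contDiff_mul_apply {E l m k : Type*} [NormedAddCommGroup E] [NormedSpace ℝ E]
    [Fintype m] {M : E → Matrix l m ℝ} {N : E → Matrix m k ℝ}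
    (hM : ∀ r c, ContDiff ℝ ∞ fun x => M x r c) (hN : ∀ r c, ContDiff ℝ ∞ fun x => N x r c)
    (r : l) (c : k) : ContDiff ℝ ∞ fun x => (M x * N x) r c := by
  simp only [Matrix.mul_apply]
  exact ContDiff.sum fun d _ => (hM r d).mul (hN d c)

theorem contDiffAt_inv_apply {E m : Type*} [NormedAddCommGroup E] [NormedSpace ℝ E]
    [Fintype m] [DecidableEq m] {M : E → Matrix m m ℝ}
    (hM : ∀ r c, ContDiff ℝ ∞ fun x => M x r c) {x₀ : E} (h0 : (M x₀).det ≠ 0) (r c : m) :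
    ContDiffAt ℝ ∞ (fun x => (M x)⁻¹ r c) x₀ := by
  simp only [Matrix.inv_def, Matrix.smul_apply, smul_eq_mul, Ring.inverse_eq_inv']
  exact ((contDiff_det hM).contDiffAt.inv h0).mul (contDiff_adjugate hM _ _).contDiffAt

theorem exists_smul_std_eq_param (g : SO n) (x : κ.Cell → ℝ) :
    ∃ h : SO n, h • std κ = param κ g x ∧ h • std κ
      = (std κ).map (changeMatrix g 1 x) (isUnit_changeMatrix g 1 x) := by
  obtain ⟨h, hh⟩ := exists_smul_std (param κ g x)
  refine ⟨h, hh, ?_⟩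
  rw [hh, param_eq]
  congr 1
  change _ = (1 : Matrix (Fin n) (Fin n) ℝ)ᵀ * _
  rw [Matrix.transpose_one, Matrix.one_mul]

theorem contDiff_isospectral_param (ha : ∑ i, (κ.mult i : ℝ) * a i = 0) (g : SO n) :
    ContDiff ℝ ∞ fun x : κ.Cell → ℝ => isospectral a ha (param κ g x) := by
  obtain ⟨b, hb⟩ := exists_sum_le_eq a
  have hD : Matrix.diagonal (fun j => a (κ.block j))
      = ∑ i, b i • (incl κ i * (incl κ i)ᵀ) := by
    ext r c
    rw [Matrix.sum_apply, Matrix.diagonal_apply]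
    simp only [incl_mul_transpose_incl, Matrix.smul_apply, Matrix.diagonal_apply, smul_eq_mul]
    split_ifs with h
    · exact (hb _).symm
    · simp
  have key : ∀ x : κ.Cell → ℝ, (isospectral a ha (param κ g x)).1
      = ∑ i, b i • colProj κ (changeMatrix g 1 x) i := by
    intro x
    obtain ⟨h, hp, hA⟩ := exists_smul_std_eq_param g x
    rw [← hp, isospectral_smul_std, FlagType.coe_smul_blockScalar, hD, Finset.mul_sum,
      Finset.sum_mul]
    refine Finset.sum_congr rfl fun i _ => ?_
    rw [colProj_eq hA, Matrix.mul_smul, Matrix.smul_mul]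
  refine SymTraceless.contDiff_of_apply fun r c => ?_
  simp only [key, Matrix.sum_apply, Matrix.smul_apply]
  refine ContDiff.sum fun i _ => ContDiff.const_smul _ ?_
  have hB : ∀ r c, ContDiff ℝ ∞ fun x : κ.Cell → ℝ => (changeMatrix g 1 x * incl κ i) r c :=
    contDiff_mul_apply (contDiff_changeMatrix g 1) fun _ _ => contDiff_const
  have hBt : ∀ r c, ContDiff ℝ ∞ fun x : κ.Cell → ℝ => (changeMatrix g 1 x * incl κ i)ᵀ r c :=
    fun r c => hB c r
  refine contDiff_mul_apply (contDiff_mul_apply hB fun r c => ?_) hBt r c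
  exact contDiff_iff_contDiffAt.2 fun x => contDiffAt_inv_apply (contDiff_mul_apply hBt hB)
    (isUnit_transpose_mul_incl (isUnit_changeMatrix g 1 x) i).ne_zero r c

/-! ### Spectral projections and the local inverse -/

/-- The Lagrange polynomial that is `1` at the weights `a l` with `l ≤ i` and `0` at the other
weights. -/
noncomputable def spectralPoly (a : Fin (p + 1) → ℝ) (i : Fin (p + 1)) : Polynomial ℝ :=
  Lagrange.interpolate Finset.univ a fun l => if l ≤ i then 1 else 0

theorem aeval_conj (g : SO n) (M : Matrix (Fin n) (Fin n) ℝ) (q : Polynomial ℝ) :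
    Polynomial.aeval (g.1 * M * (g.1)ᵀ) q = g.1 * Polynomial.aeval M q * (g.1)ᵀ := by
  have hpow : ∀ k : ℕ, (g.1 * M * (g.1)ᵀ) ^ k = g.1 * M ^ k * (g.1)ᵀ := by
    intro k
    induction k with
    | zero => simp [g.mul_transpose]
    | succ k ih =>
      rw [pow_succ, ih, pow_succ]
      simp only [Matrix.mul_assoc]
      rw [← Matrix.mul_assoc (g.1)ᵀ, g.transpose_mul, Matrix.one_mul]
  rw [Polynomial.aeval_eq_sum_range, Polynomial.aeval_eq_sum_range, Finset.mul_sum,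
    Finset.sum_mul]
  exact Finset.sum_congr rfl fun k _ => by rw [hpow, Matrix.mul_smul, Matrix.smul_mul]

theorem aeval_spectralPoly_diagonal (hinj : Function.Injective a) (i : Fin (p + 1)) :
    Polynomial.aeval (Matrix.diagonal fun j => a (κ.block j)) (spectralPoly a i)
      = incl κ i * (incl κ i)ᵀ := by
  have h := Polynomial.aeval_algHom_apply (Matrix.diagonalAlgHom (n := Fin n) (α := ℝ) ℝ)
    (fun j => a (κ.block j)) (spectralPoly a i)
  rw [Matrix.diagonalAlgHom_apply, Matrix.diagonalAlgHom_apply] at h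
  rw [h, incl_mul_transpose_incl, Polynomial.aeval_pi_apply]
  congr 1
  funext j
  rw [Polynomial.coe_aeval_eq_eval, spectralPoly,
    Lagrange.eval_interpolate_at_node _ hinj.injOn (Finset.mem_univ _)]

theorem contDiff_aeval_apply (q : Polynomial ℝ) (r c : Fin n) :
    ContDiff ℝ ∞ fun X : SymTraceless n => (Polynomial.aeval X.1 q) r c := by
  have hpow : ∀ (k : ℕ) (r c : Fin n), ContDiff ℝ ∞ fun X : SymTraceless n => (X.1 ^ k) r c := by
    intro k
    induction k with
    | zero => intro r c; simpa using contDiff_const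
    | succ k ih =>
      simp only [pow_succ]
      exact contDiff_mul_apply ih (SymTraceless.contDiff_apply n)
  simp only [Polynomial.aeval_eq_sum_range, Matrix.sum_apply, Matrix.smul_apply]
  exact ContDiff.sum fun k _ => ContDiff.const_smul _ (hpow k r c)

/-- The conjugate by `g⁻¹` of the value at `X` of the polynomial `spectralPoly a i`. If `X` has the
eigenvalues `a`, that value is the orthogonal projection onto the sum of the eigenspaces of `a l`
for `l ≤ i`. -/
noncomputable def spectralProj (a : Fin (p + 1) → ℝ) (g : SO n) (i : Fin (p + 1))
    (X : SymTraceless n) : Matrix (Fin n) (Fin n) ℝ :=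
  (g.1)ᵀ * Polynomial.aeval X.1 (spectralPoly a i) * g.1

/-- The coordinates, in the chart centred at `g • std κ`, of the flag of sums of eigenspaces
of `X`. -/
noncomputable def spectralCoord (κ : FlagType p n) (a : Fin (p + 1) → ℝ) (g : SO n)
    (X : SymTraceless n) (rc : κ.Cell) : ℝ :=
  coord κ (spectralProj a g (κ.block rc.1.2) X) rc

/-- The set of the matrices `X` for which the minors inverted in `spectralCoord κ a g` are
invertible. -/
def spectralCell (κ : FlagType p n) (a : Fin (p + 1) → ℝ) (g : SO n) : Set (SymTraceless n) :=
  {X | ∀ i : Fin p, (minor κ (spectralProj a g i.castSucc X) i.castSucc).det ≠ 0}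

theorem contDiff_spectralProj_apply (g : SO n) (i : Fin (p + 1)) (r c : Fin n) :
    ContDiff ℝ ∞ fun X => spectralProj a g i X r c := by
  have h : ∀ r c, ContDiff ℝ ∞ fun X : SymTraceless n =>
      ((g.1)ᵀ * Polynomial.aeval X.1 (spectralPoly a i)) r c :=
    contDiff_mul_apply (M := fun _ => (g.1)ᵀ) (fun _ _ => contDiff_const)
      (contDiff_aeval_apply _)
  exact contDiff_mul_apply (N := fun _ => g.1) h (fun _ _ => contDiff_const) r c

theorem isOpen_spectralCell (g : SO n) : IsOpen (spectralCell κ a g) := by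
  rw [spectralCell, Set.ofPred_forall]
  refine isOpen_iInter_of_finite fun i => ?_
  exact isOpen_ne_fun
    (contDiff_det fun _ _ => contDiff_spectralProj_apply g _ _ _).continuous continuous_const

theorem contDiffAt_spectralCoord {g : SO n} {X : SymTraceless n}
    (hX : X ∈ spectralCell κ a g) : ContDiffAt ℝ ∞ (spectralCoord κ a g) X := by
  rw [contDiffAt_pi]
  rintro ⟨⟨r, c⟩, hrc⟩
  obtain ⟨j, hj⟩ : ∃ j : Fin p, j.castSucc = κ.block c :=
    Fin.exists_castSucc_eq.2 (hrc.trans_le (Fin.le_last _)).ne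
  simp only [spectralCoord, coord]
  refine ContDiffAt.sum fun d _ => (contDiff_spectralProj_apply g _ _ _).contDiffAt.mul ?_
  refine contDiffAt_inv_apply (fun _ _ => contDiff_spectralProj_apply g _ _ _) ?_ _ _
  rw [← hj]
  exact hX j

theorem spectralProj_isospectral (ha : ∑ i, (κ.mult i : ℝ) * a i = 0)
    (hinj : Function.Injective a) (g h : SO n) (i : Fin (p + 1)) :
    spectralProj a g i (isospectral a ha (h • std κ))
      = (g⁻¹ * h).1 * (incl κ i * (incl κ i)ᵀ) * ((g⁻¹ * h).1)ᵀ := by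
  rw [isospectral_smul_std, spectralProj, FlagType.coe_smul_blockScalar, aeval_conj,
    aeval_spectralPoly_diagonal hinj]
  have h1 : (g⁻¹ * h).1 = (g.1)ᵀ * h.1 := rfl
  rw [h1, Matrix.transpose_mul, Matrix.transpose_transpose]
  simp only [Matrix.mul_assoc]

/-- The image of `F` lies in the domain of the spectral coordinates exactly when these are the
coordinates of `F`; in particular, `F` then lies in the chart centred at `g • std κ`. -/
theorem isospectral_mem_spectralCell_iff (ha : ∑ i, (κ.mult i : ℝ) * a i = 0)
    (hinj : Function.Injective a) (g : SO n) (F : FlagManifold κ) :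
    isospectral a ha F ∈ spectralCell κ a g ↔
      param κ g (spectralCoord κ a g (isospectral a ha F)) = F := by
  obtain ⟨h, rfl⟩ := exists_smul_std F
  obtain ⟨A, hAdef⟩ : ∃ A, A = g⁻¹ * h := ⟨_, rfl⟩
  have hmem : isospectral a ha (h • std κ) ∈ spectralCell κ a g ↔
      ∀ i : Fin p, (minor κ A.1 i.castSucc).det ≠ 0 := by
    refine forall_congr' fun i => ?_
    rw [spectralProj_isospectral ha hinj, ← hAdef, minor_mul_incl_mul_transpose, Matrix.det_mul,
      Matrix.det_transpose, mul_self_ne_zero]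
  have hparam : ∀ x, param κ g x = h • std κ ↔
      (std κ).map (1 + lower κ x) (isUnit_lower x) = (std κ).map A.1 A.isUnit := fun x => by
    rw [param, smul_eq_iff_eq_inv_smul, smul_smul, ← hAdef]
    rfl
  rw [hmem, hparam]
  constructor
  · intro H
    have hcoord : spectralCoord κ a g (isospectral a ha (h • std κ)) = coord κ A.1 := by
      funext rc
      obtain ⟨j, hj⟩ : ∃ j : Fin p, j.castSucc = κ.block rc.1.2 :=
        Fin.exists_castSucc_eq.2 (rc.2.trans_le (Fin.le_last _)).ne
      rw [spectralCoord, spectralProj_isospectral ha hinj, ← hAdef]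
      exact coord_mul_incl_mul_transpose _ _ (hj ▸ H j)
    rw [hcoord]
    exact map_lower_coord _ A.isUnit H
  · intro H
    exact det_minor_ne_zero H

theorem isospectral_param_mem (ha : ∑ i, (κ.mult i : ℝ) * a i = 0)
    (hinj : Function.Injective a) (g : SO n) (x : κ.Cell → ℝ) :
    isospectral a ha (param κ g x) ∈ spectralCell κ a g := by
  obtain ⟨h, hh⟩ := exists_smul_std (param κ g x)
  intro i
  have h1 : (std κ).map (1 + lower κ x) (isUnit_lower x)
      = (std κ).map (g⁻¹ * h).1 (g⁻¹ * h).isUnit := by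
    have h2 := hh.symm
    rw [param, smul_eq_iff_eq_inv_smul, smul_smul] at h2
    exact h2
  rw [← hh, spectralProj_isospectral ha hinj, minor_mul_incl_mul_transpose, Matrix.det_mul,
    Matrix.det_transpose, mul_self_ne_zero]
  exact det_minor_ne_zero h1 i

theorem spectralCoord_isospectral_param (ha : ∑ i, (κ.mult i : ℝ) * a i = 0)
    (hinj : Function.Injective a) (g : SO n) (x : κ.Cell → ℝ) :
    spectralCoord κ a g (isospectral a ha (param κ g x)) = x :=
  param_injective g ((isospectral_mem_spectralCell_iff ha hinj g _).1
    (isospectral_param_mem ha hinj g x))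

theorem injective_fderiv_isospectral_param (ha : ∑ i, (κ.mult i : ℝ) * a i = 0)
    (hinj : Function.Injective a) (g : SO n) (x : κ.Cell → ℝ) :
    Function.Injective
      (fderiv ℝ (fun x : κ.Cell → ℝ => isospectral a ha (param κ g x)) x) := by
  have h1 := ((contDiff_isospectral_param ha g).differentiable (by simp) x).hasFDerivAt
  have h2 := ((contDiffAt_spectralCoord (isospectral_param_mem ha hinj g x)).differentiableAt
    (by simp)).hasFDerivAt
  have hid : (spectralCoord κ a g ∘ fun x : κ.Cell → ℝ => isospectral a ha (param κ g x)) = id :=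
    funext fun y => spectralCoord_isospectral_param ha hinj g y
  have h3 := h2.comp x h1
  rw [hid] at h3
  replace h3 := h3.unique (hasFDerivAt_id x)
  exact Function.LeftInverse.injective fun v => DFunLike.congr_fun h3 v

/-! ### The embedding -/

theorem finrank_cell_le (ha : ∑ i, (κ.mult i : ℝ) * a i = 0) (hinj : Function.Injective a) :
    Module.finrank ℝ (κ.Cell → ℝ) ≤ Module.finrank ℝ (SymTraceless n) :=
  LinearMap.finrank_le_finrank_of_injective
    (f := (fderiv ℝ (fun x : κ.Cell → ℝ => isospectral a ha (param κ 1 x)) 0).toLinearMap)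
    (injective_fderiv_isospectral_param ha hinj 1 0)

theorem isImmersion_isospectral (ha : ∑ i, (κ.mult i : ℝ) * a i = 0)
    (hinj : Function.Injective a) :
    Manifold.IsImmersion 𝓘(ℝ, κ.Cell → ℝ) 𝓘(ℝ, SymTraceless n) ∞
      (isospectral (κ := κ) a ha) := by
  -- An immersion has one complement for all points, so it is chosen by its dimension alone.
  refine Manifold.IsImmersionOfComplement.isImmersion (F := Fin (Module.finrank ℝ (SymTraceless n)
    - Module.finrank ℝ (κ.Cell → ℝ)) → ℝ) fun F => ?_
  refine isImmersionAtOfComplement_of_injective_fderiv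
    (IsManifold.chart_mem_maximalAtlas (I := 𝓘(ℝ, κ.Cell → ℝ)) F)
    (_root_.mem_chart_source (κ.Cell → ℝ) F)
    (contDiff_isospectral_param ha (exists_smul_std F).choose) (fun u _ => rfl)
    (injective_fderiv_isospectral_param ha hinj _ _) ?_
  rw [Module.finrank_fin_fun]
  exact Nat.add_sub_cancel' (finrank_cell_le ha hinj)

theorem continuous_param (g : SO n) : Continuous (param κ g) := by
  rw [← continuousOn_univ]
  exact ((chartedSpaceCore κ).openPartialHomeomorph (chart κ g)
    (Set.mem_range_self g)).continuousOn_symm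

/-- The map `X ↦ param κ g (spectralCoord κ a g X)` is a local continuous inverse near the image of
`g • std κ`, defined on an open set whose preimage is contained in the chart. -/
theorem isEmbedding_isospectral (ha : ∑ i, (κ.mult i : ℝ) * a i = 0)
    (hinj : Function.Injective a) :
    Topology.IsEmbedding (isospectral (κ := κ) a ha) := by
  have hcell : ∀ g : SO n, isospectral a ha (g • std κ) ∈ spectralCell κ a g := fun g => by
    obtain ⟨x, hx⟩ := mem_chart_source (κ := κ) g
    rw [← hx]
    exact isospectral_param_mem ha hinj g x
  refine ⟨Topology.isInducing_iff_nhds.2 fun F => le_antisymm ?_ ?_, ?_⟩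
  · exact Filter.map_le_iff_le_comap.1
      (isImmersion_isospectral ha hinj).contMDiff.continuous.continuousAt
  · obtain ⟨g, rfl⟩ := exists_smul_std F
    intro s hs
    have hcont : ContinuousAt (fun X => param κ g (spectralCoord κ a g X))
        (isospectral a ha (g • std κ)) :=
      (continuous_param g).continuousAt.comp (contDiffAt_spectralCoord (hcell g)).continuousAt
    have hs' : (fun X => param κ g (spectralCoord κ a g X)) ⁻¹' s
        ∈ 𝓝 (isospectral a ha (g • std κ)) := by
      refine hcont ?_
      beta_reduce
      rwa [(isospectral_mem_spectralCell_iff ha hinj g _).1 (hcell g)]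
    refine ⟨_, Filter.inter_mem hs' ((isOpen_spectralCell g).mem_nhds (hcell g)), ?_⟩
    rintro F' ⟨h1, h2⟩
    rwa [Set.mem_preimage, (isospectral_mem_spectralCell_iff ha hinj g F').1 h2] at h1
  · intro F F' h
    obtain ⟨g, rfl⟩ := exists_smul_std F
    have h1 := (isospectral_mem_spectralCell_iff ha hinj g _).1 (hcell g)
    have h2 := (isospectral_mem_spectralCell_iff ha hinj g F').1 (h ▸ hcell g)
    rw [← h1, ← h2, h]

end FlagManifold

theorem mainTheorem4 {p n : ℕ} (κ : FlagType p n) :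
    (∃ a : Fin (p + 1) → ℝ, Function.Injective a ∧ ∑ i, (κ.mult i : ℝ) * a i = 0) ∧
    ∀ (a : Fin (p + 1) → ℝ), Function.Injective a →
      ∀ ha : ∑ i, (κ.mult i : ℝ) * a i = 0,
        (MulAction.stabilizer (SO n) (κ.blockScalar a ha) : Set (SO n)) = κ.blockOrthogonal ∧
        ∃ ε : FlagManifold κ → SymTraceless n,
          Manifold.IsSmoothEmbedding 𝓘(ℝ, κ.Cell → ℝ) 𝓘(ℝ, SymTraceless n) ∞ ε ∧
          (∀ (Q : SO n) (F : FlagManifold κ), ε (Q • F) = Q • ε F) ∧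
          ε (FlagManifold.std κ) = κ.blockScalar a ha ∧
          Set.range ε = MulAction.orbit (SO n) (κ.blockScalar a ha) := by
  refine ⟨κ.exists_injective_weights, fun a hinj ha =>
    ⟨FlagType.stabilizer_blockScalar ha hinj, FlagManifold.isospectral a ha, ⟨?_, ?_⟩, ?_, ?_, ?_⟩⟩
  · exact FlagManifold.isImmersion_isospectral ha hinj
  · exact FlagManifold.isEmbedding_isospectral ha hinj
  · exact FlagManifold.isospectral_smul ha
  · exact FlagManifold.isospectral_std ha
  · exact FlagManifold.range_isospectral ha
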